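/- Let $(M,d_M)$ be a compact metric space with $\operatorname{diam}(M)=1$ and let $\nu$ be a Borel probability measure on $M$ with support equal to $M$. Let $\Omega=M^{\mathbb N}$ with the product topology, the metric $d(x,y)=\sum_{n\ge1}2^{-n}d_M(x_n,y_n)$ and the shift $\sigma(x_1,x_2,\dots)=(x_2,x_3,\dots)$. Write $\mathrm{C}(\Omega)$ for the continuous functions and $\mathrm{Lip}(\Omega)$ for the Lipschitz functions $\Omega\to\mathbb R$. For $f\in\mathrm{Lip}(\Omega)$ the Ruelle operator is $$\mathcal L_f(u)(x)=\int_M e^{f(ax)}u(ax)\,d\nu(a),\qquad ax=(a,x_1,x_2,\dots),$$ and $\mathrm{Ker}(\mathcal L_f)=\{u\in\mathrm{Lip}(\Omega):\mathcal L_f(u)=0\}$. The potential $f$ is called normalized if $\mathcal L_f(1)=1$. For $f\in\mathrm{Lip}(\Omega)$, the Lipschitz-Gibbs probability $\mu_f$ is the Borel probability measure on $\Omega$ with $\mathcal L_{N(f)}^*\mu_f=\mu_f$, where $N(f)=f+\log w_f-\log(w_f\circ\sigma)-\log\lambda_f$ and $\lambda_f>0$, $w_f\in\mathrm{Lip}(\Omega)$,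 $w_f>0$ satisfy $\mathcal L_f(w_f)=\lambda_f w_f$ (by the Ruelle-Perron-Frobenius theorem $\lambda_f$ and $\mu_f$ exist and are unique, and $w_f$ exists and is unique up to a positive factor). Let $f,g,\varphi\in\mathrm{Lip}(\Omega)$ with $f$ normalized. Assume that there are $v,w\in\mathrm{C}(\Omega)$, $\eta,\xi\in\mathrm{Ker}(\mathcal L_f)$ and $c\in\mathbb R$ such that $$g=\eta+(v-v\circ\sigma),\qquad \varphi=\xi+(w-w\circ\sigma)+c .$$ Then the function $t\mapsto\int_\Omega\varphi\,d\mu_{f+tg}$ is differentiable at $t=0$ and $$\frac{d}{dt}\int_\Omega\varphi\,d\mu_{f+tg}\Big|_{t=0}=\int_\Omega\xi\,\eta\,d\mu_f .$$ -/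

import Mathlib

open MeasureTheory

noncomputable section

/-- The distance `d(x, y) = ∑_{n ≥ 1} 2^{-n} d_M(x_n, y_n)` on the sequence space `Ω = M^ℕ`
(coordinates are indexed from `0` here, so the weight of coordinate `n` is `2^{-(n+1)}`). -/
def seqDist {M : Type*} [MetricSpace M] (x y : ℕ → M) : ℝ :=
  ∑' n : ℕ, (1 / 2 : ℝ) ^ (n + 1) * dist (x n) (y n)

/-- `u ∈ Lip(Ω)`: the function `u : Ω → ℝ` is Lipschitz for the distance `seqDist`. -/
def IsLip {M : Type*} [MetricSpace M] (u : (ℕ → M) → ℝ) : Prop :=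
  ∃ K : ℝ, ∀ x y : ℕ → M, |u x - u y| ≤ K * seqDist x y

/-- The shift map `(x_0, x_1, x_2, …) ↦ (x_1, x_2, …)`. -/
def shift {M : Type*} (x : ℕ → M) : ℕ → M := fun n => x (n + 1)

/-- The sequence `ax = (a, x_0, x_1, …)`. -/
def prepend {M : Type*} (a : M) (x : ℕ → M) : ℕ → M
  | 0 => a
  | n + 1 => x n

/-- The Ruelle operator of the potential `f` with a priori measure `ν`:
`(L_f w)(x) = ∫_M e^{f(ax)} w(ax) dν(a)`. -/
def ruelle {M : Type*} [MeasurableSpace M] (ν : Measure M)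
    (f w : (ℕ → M) → ℝ) (x : ℕ → M) : ℝ :=
  ∫ a, Real.exp (f (prepend a x)) * w (prepend a x) ∂ν

/-- `f ∈ N(Ω)`: `f` is Lipschitz and `L_f 1 = 1`. -/
def IsNormalized {M : Type*} [MetricSpace M] [MeasurableSpace M] (ν : Measure M)
    (f : (ℕ → M) → ℝ) : Prop :=
  IsLip f ∧ ∀ x, ruelle ν f (fun _ => 1) x = 1

/-- `Ker(L_f)`, for `L_f` acting on `Lip(Ω)`. -/
def ruelleKer {M : Type*} [MetricSpace M] [MeasurableSpace M] (ν : Measure M)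
    (f : (ℕ → M) → ℝ) : Set ((ℕ → M) → ℝ) :=
  {η | IsLip η ∧ ∀ x, ruelle ν f η x = 0}

/-- `lam > 0` and the strictly positive Lipschitz function `h` satisfy `L_f h = lam h`. -/
def IsPosEigenpair {M : Type*} [MetricSpace M] [MeasurableSpace M] (ν : Measure M)
    (f : (ℕ → M) → ℝ) (lam : ℝ) (h : (ℕ → M) → ℝ) : Prop :=
  0 < lam ∧ IsLip h ∧ (∀ x, 0 < h x) ∧ ∀ x, ruelle ν f h x = lam * h x

/-- The normalization `N(f) = f + log h - log (h ∘ σ) - log lam` built from an eigenpair. -/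
def normalization {M : Type*} (f : (ℕ → M) → ℝ) (lam : ℝ) (h : (ℕ → M) → ℝ) :
    (ℕ → M) → ℝ :=
  fun x => f x + Real.log (h x) - Real.log (h (shift x)) - Real.log lam

/-- `L_F^* μ = μ`, where `L_F^*` is the dual of the Ruelle operator on `C(Ω)`. -/
def IsDualFixed {M : Type*} [MetricSpace M] [MeasurableSpace M] (ν : Measure M)
    (F : (ℕ → M) → ℝ) (μ : Measure (ℕ → M)) : Prop :=
  ∀ u : (ℕ → M) → ℝ, Continuous u → ∫ x, ruelle ν F u x ∂μ = ∫ x, u x ∂μ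

/-- `μ` is a Lipschitz-Gibbs probability for `f`: a Borel probability on `Ω` with
`L_{N(f)}^* μ = μ`. -/
def IsLipschitzGibbs {M : Type*} [MetricSpace M] [MeasurableSpace M] (ν : Measure M)
    (f : (ℕ → M) → ℝ) (μ : Measure (ℕ → M)) : Prop :=
  IsProbabilityMeasure μ ∧
    ∃ (lam : ℝ) (h : (ℕ → M) → ℝ), IsPosEigenpair ν f lam h ∧
      IsDualFixed ν (normalization f lam h) μ

open Classical in
/-- The Lipschitz-Gibbs probability `μ_f` of `f`. For Lipschitz `f` on a compact `M` it exists
and is unique (Ruelle-Perron-Frobenius theorem), so that the second branch is never used there. -/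
def gibbs {M : Type*} [MetricSpace M] [MeasurableSpace M] (ν : Measure M)
    (f : (ℕ → M) → ℝ) : Measure (ℕ → M) :=
  if H : ∃ μ, IsLipschitzGibbs ν f μ then H.choose else 0

end

open Filter Topology
open scoped BoundedContinuousFunction

/-! Write `L` for `L_f`. A coboundary in the potential only changes eigenfunctions: if `h` is a
positive eigenfunction for `f + t g`, then `k = e^{tv} h` is one for `f + t η`, with the same
eigenvalue `λ`. A Gibbs probability `μ_t` of `f + t g` therefore satisfies `∫ L(q_t u) dμ_t = ∫ u
dμ_t` with `q_t = e^{tη} k / (λ · k∘σ)`.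

Since `L η = 0`, the first-order perturbation of `L` does not move the eigendata: once `k` is scaled
to be 1 at a base point, `k` and `λ` are `1 + O(t²)`, hence `q_t = 1 + tη + O(t²)` uniformly
(`exists_eigen_estimate`, `exists_density_estimate`). With `L ξ = 0` this gives `∫ ξ dμ_t = ∫ L(q_t
ξ) dμ_t = t ∫ L(ηξ) dμ_t + O(t²)`. Integrals of Lipschitz functions against `μ_t` are within
`O(|t|)` of those against `μ_0` (`exists_abs_integral_sub_le`), and `∫ L(ηξ) dμ_0 = ∫ ηξ dμ_0`. So
`∫ ξ dμ_t = t ∫ ξη dμ_0 + O(t²)`. Finally `μ_t` is shift invariant, so `φ` and `ξ + c` have the same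
integral.

The analytic engine is `exists_gap`: a cone argument shows that `L^n` shrinks Lipschitz constants
geometrically, which inverts `1 - L` modulo constants. All estimates hold for every Gibbs
probability, so uniqueness is never used. Existence is used, because `gibbs` is defined by choice;
it comes from a discounted eigenvalue equation and from Cesàro averages of a Markov operator. -/

/-- `u` is Lipschitz for `seqDist` with constant `B`. -/
def HasLip {M : Type*} [MetricSpace M] (u : (ℕ → M) → ℝ) (B : ℝ) : Prop :=
  ∀ x y, |u x - u y| ≤ B * seqDist x y

lemma shift_prepend {M : Type*} (a : M) (x : ℕ → M) : shift (prepend a x) = x := rfl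

/-! ### The metric on the sequence space. -/

section Distance

variable {M : Type*} [MetricSpace M]

lemma seqDist_term_nonneg (x y : ℕ → M) (n : ℕ) :
    0 ≤ (1 / 2 : ℝ) ^ (n + 1) * dist (x n) (y n) := by positivity

lemma seqDist_term_le (hd : ∀ a b : M, dist a b ≤ 1) (x y : ℕ → M) (n : ℕ) :
    (1 / 2 : ℝ) ^ (n + 1) * dist (x n) (y n) ≤ (1 / 2 : ℝ) ^ (n + 1) :=
  mul_le_of_le_one_right (by positivity) (hd _ _)

lemma hasSum_half_pow_succ : HasSum (fun n : ℕ => (1 / 2 : ℝ) ^ (n + 1)) 1 := by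
  have h := hasSum_geometric_two.mul_left (1 / 2 : ℝ)
  simpa [pow_succ, mul_comm] using h

lemma seqDist_summable (hd : ∀ a b : M, dist a b ≤ 1) (x y : ℕ → M) :
    Summable fun n : ℕ => (1 / 2 : ℝ) ^ (n + 1) * dist (x n) (y n) :=
  Summable.of_nonneg_of_le (seqDist_term_nonneg x y) (seqDist_term_le hd x y)
    hasSum_half_pow_succ.summable

lemma seqDist_nonneg (x y : ℕ → M) : 0 ≤ seqDist x y := tsum_nonneg (seqDist_term_nonneg x y)

lemma seqDist_le_one (hd : ∀ a b : M, dist a b ≤ 1) (x y : ℕ → M) : seqDist x y ≤ 1 := by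
  rw [← hasSum_half_pow_succ.tsum_eq]
  exact (seqDist_summable hd x y).tsum_le_tsum (seqDist_term_le hd x y)
    hasSum_half_pow_succ.summable

lemma seqDist_comm (x y : ℕ → M) : seqDist x y = seqDist y x := by
  simp [seqDist, dist_comm]

lemma seqDist_self (x : ℕ → M) : seqDist x x = 0 := by simp [seqDist]

/-- The source of every contraction below: the common first symbol contributes nothing, and every
other coordinate moves to half its weight. -/
lemma seqDist_prepend (hd : ∀ a b : M, dist a b ≤ 1) (a : M) (x y : ℕ → M) :
    seqDist (prepend a x) (prepend a y) = seqDist x y / 2 := by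
  have h := (seqDist_summable hd (prepend a x) (prepend a y)).tsum_eq_zero_add
  rw [seqDist, h, seqDist, ← tsum_div_const]
  simp only [prepend, dist_self, mul_zero, zero_add]
  exact tsum_congr fun n => by ring

lemma continuous_prepend : Continuous fun p : (ℕ → M) × M => prepend p.2 p.1 := by
  refine continuous_pi fun n => ?_
  cases n with
  | zero => exact continuous_snd
  | succ n => exact (continuous_apply n).comp continuous_fst

lemma continuous_shift : Continuous (shift : (ℕ → M) → ℕ → M) :=
  continuous_pi fun n => continuous_apply (n + 1)

lemma continuous_seqDist (hd : ∀ a b : M, dist a b ≤ 1) :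
    Continuous fun p : (ℕ → M) × (ℕ → M) => seqDist p.1 p.2 := by
  refine continuous_tsum (fun n => ?_) hasSum_half_pow_succ.summable fun n p => ?_
  · fun_prop
  · rw [Real.norm_of_nonneg (seqDist_term_nonneg _ _ n)]
    exact seqDist_term_le hd _ _ n

end Distance

/-! ### Calculus of Lipschitz constants. -/

namespace HasLip

variable {M : Type*} [MetricSpace M] {u w : (ℕ → M) → ℝ} {B B' S S' : ℝ}

lemma continuous (hd : ∀ a b : M, dist a b ≤ 1) (hu : HasLip u B) : Continuous u := by
  refine continuous_iff_continuousAt.2 fun x => ?_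
  rw [ContinuousAt, tendsto_iff_dist_tendsto_zero]
  have h : Filter.Tendsto (fun y => B * seqDist y x) (nhds x) (nhds 0) := by
    have hc : Continuous fun y : ℕ → M => B * seqDist y x :=
      continuous_const.mul ((continuous_seqDist hd).comp (by fun_prop :
        Continuous fun y : ℕ → M => (y, x)))
    simpa [seqDist_self] using hc.tendsto x
  exact squeeze_zero (fun _ => dist_nonneg) (fun y => hu y x) h

lemma mono (hu : HasLip u B) (h : B ≤ B') : HasLip u B' := fun x y =>
  (hu x y).trans (mul_le_mul_of_nonneg_right h (seqDist_nonneg x y))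

lemma abs_sub_le (hd : ∀ a b : M, dist a b ≤ 1) (hB : 0 ≤ B) (hu : HasLip u B) (x y : ℕ → M) :
    |u x - u y| ≤ B :=
  (hu x y).trans (mul_le_of_le_one_right hB (seqDist_le_one hd x y))

lemma const (c : ℝ) : HasLip (fun _ : ℕ → M => c) 0 := fun x y => by simp

lemma add (hu : HasLip u B) (hw : HasLip w B') : HasLip (fun x => u x + w x) (B + B') :=
  fun x y => by
    have h1 := hu x y
    have h2 := hw x y
    rw [abs_le] at *
    constructor <;> linarith

lemma const_mul (c : ℝ) (hu : HasLip u B) : HasLip (fun x => c * u x) (|c| * B) := fun x y => by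
  rw [← mul_sub, abs_mul, mul_assoc]
  exact mul_le_mul_of_nonneg_left (hu x y) (abs_nonneg c)

lemma neg (hu : HasLip u B) : HasLip (fun x => -u x) B := fun x y => by
  rw [neg_sub_neg, abs_sub_comm]
  exact hu x y

lemma sub (hu : HasLip u B) (hw : HasLip w B') : HasLip (fun x => u x - w x) (B + B') := by
  simpa [sub_eq_add_neg] using hu.add hw.neg

lemma add_const (hu : HasLip u B) (c : ℝ) : HasLip (fun x => u x + c) B := by
  simpa using hu.add (const c)

lemma sub_const (hu : HasLip u B) (c : ℝ) : HasLip (fun x => u x - c) B := by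
  simpa using hu.sub (const c)

lemma mul (hu : HasLip u B) (hw : HasLip w B') (hS : ∀ x, |u x| ≤ S) (hS' : ∀ x, |w x| ≤ S') :
    HasLip (fun x => u x * w x) (S * B' + B * S') := fun x y => by
  have e : u x * w x - u y * w y = u x * (w x - w y) + (u x - u y) * w y := by ring
  rw [e]
  refine (abs_add_le _ _).trans ?_
  rw [abs_mul, abs_mul]
  have h1 := mul_le_mul (hS x) (hw x y) (abs_nonneg _) ((abs_nonneg _).trans (hS x))
  have h2 := mul_le_mul (hu x y) (hS' y) (abs_nonneg _) ((abs_nonneg _).trans (hu x y))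
  nlinarith

/-- Composition with a real function that is Lipschitz on the range. -/
lemma comp {F : ℝ → ℝ} {c : ℝ} (hc : 0 ≤ c) (hu : HasLip u B)
    (hF : ∀ x y, |F (u x) - F (u y)| ≤ c * |u x - u y|) : HasLip (fun x => F (u x)) (c * B) :=
  fun x y => (hF x y).trans <| by
    rw [mul_assoc]
    exact mul_le_mul_of_nonneg_left (hu x y) hc

/-- A self-improving Lipschitz constant is at most the fixed point of the improvement. -/
lemma of_improve {a b : ℝ} (ha : 0 ≤ a) (ha1 : a < 1) (hB : 0 ≤ B) (hb : 0 ≤ b)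
    (hu : HasLip u B) (h : ∀ B, 0 ≤ B → HasLip u B → HasLip u (a * B + b)) :
    HasLip u (b / (1 - a)) := by
  -- The a priori constant `B` only starts the iteration; its weight `a ^ n` disappears in the
  -- limit.
  have key : ∀ n : ℕ, HasLip u (a ^ n * B + b / (1 - a)) := by
    intro n
    have h1 : 0 < 1 - a := by linarith
    induction n with
    | zero => exact hu.mono (by simpa using div_nonneg hb h1.le)
    | succ n ih =>
      refine (h _ (by positivity) ih).mono (le_of_eq ?_)
      field_simp
      ring
  intro x y
  have ht : Filter.Tendsto (fun n : ℕ => (a ^ n * B + b / (1 - a)) * seqDist x y) Filter.atTop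
      (nhds ((0 * B + b / (1 - a)) * seqDist x y)) :=
    (((tendsto_pow_atTop_nhds_zero_of_lt_one ha ha1).mul_const B).add_const _).mul_const _
  rw [zero_mul, zero_add] at ht
  exact ge_of_tendsto' ht fun n => key n x y

end HasLip

lemma IsLip.exists_hasLip {M : Type*} [MetricSpace M] {u : (ℕ → M) → ℝ} (hu : IsLip u) :
    ∃ B, 0 ≤ B ∧ HasLip u B := by
  obtain ⟨K, hK⟩ := hu
  exact ⟨max K 0, le_max_right _ _, HasLip.mono hK (le_max_left _ _)⟩

lemma HasLip.isLip {M : Type*} [MetricSpace M] {u : (ℕ → M) → ℝ} {B : ℝ} (hu : HasLip u B) :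
    IsLip u := ⟨B, hu⟩

lemma exists_abs_le {X : Type*} [TopologicalSpace X] [CompactSpace X] {u : X → ℝ}
    (hu : Continuous u) : ∃ C, 0 ≤ C ∧ ∀ x, |u x| ≤ C := by
  obtain ⟨C, hC⟩ := isCompact_univ.exists_bound_of_continuousOn hu.continuousOn
  exact ⟨max C 0, le_max_right _ _, fun x => (hC x trivial).trans (le_max_left _ _)⟩

lemma Continuous.integrable_of_compactSpace {X : Type*} [TopologicalSpace X] [CompactSpace X]
    [SecondCountableTopology X] [MeasurableSpace X] [OpensMeasurableSpace X] (μ : Measure X)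
    [IsFiniteMeasure μ] {u : X → ℝ} (hu : Continuous u) : Integrable u μ := by
  obtain ⟨C, -, hC⟩ := exists_abs_le hu
  exact Integrable.of_bound hu.aestronglyMeasurable C (Filter.Eventually.of_forall hC)

/-! ### The Ruelle operator on continuous functions. -/

lemma ruelle_const_mul {M : Type*} [MeasurableSpace M] (ν : Measure M) {F u : (ℕ → M) → ℝ}
    (c : ℝ) (x : ℕ → M) : ruelle ν F (fun y => c * u y) x = c * ruelle ν F u x := by
  simp only [ruelle, ← integral_const_mul]
  congr 1
  ext a
  ring

lemma continuous_ruelle_integrand {M : Type*} [MetricSpace M] {F u : (ℕ → M) → ℝ}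
    (hF : Continuous F) (hu : Continuous u) :
    Continuous fun p : (ℕ → M) × M => Real.exp (F (prepend p.2 p.1)) * u (prepend p.2 p.1) :=
  (Real.continuous_exp.comp (hF.comp continuous_prepend)).mul (hu.comp continuous_prepend)

section Ruelle

variable {M : Type*} [MetricSpace M] [CompactSpace M] [MeasurableSpace M] [BorelSpace M]
  (ν : Measure M) [IsProbabilityMeasure ν] {F u w : (ℕ → M) → ℝ}

lemma integrable_ruelle_integrand (hF : Continuous F) (hu : Continuous u) (x : ℕ → M) :
    Integrable (fun a => Real.exp (F (prepend a x)) * u (prepend a x)) ν :=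
  Continuous.integrable_of_compactSpace ν ((continuous_ruelle_integrand hF hu).comp
    (by fun_prop : Continuous fun a : M => (x, a)))

lemma continuous_ruelle (hF : Continuous F) (hu : Continuous u) : Continuous (ruelle ν F u) := by
  have h := continuous_parametric_integral_of_continuous (μ := ν) (s := Set.univ)
    (f := fun (x : ℕ → M) (a : M) => Real.exp (F (prepend a x)) * u (prepend a x))
    (continuous_ruelle_integrand hF hu) isCompact_univ
  simp only [Measure.restrict_univ] at h
  exact h

lemma ruelle_add (hF : Continuous F) (hu : Continuous u) (hw : Continuous w) (x : ℕ → M) :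
    ruelle ν F (fun y => u y + w y) x = ruelle ν F u x + ruelle ν F w x := by
  simp only [ruelle, mul_add]
  exact integral_add (integrable_ruelle_integrand ν hF hu x) (integrable_ruelle_integrand ν hF hw x)

lemma ruelle_sub (hF : Continuous F) (hu : Continuous u) (hw : Continuous w) (x : ℕ → M) :
    ruelle ν F (fun y => u y - w y) x = ruelle ν F u x - ruelle ν F w x := by
  simp only [ruelle, mul_sub]
  exact integral_sub (integrable_ruelle_integrand ν hF hu x) (integrable_ruelle_integrand ν hF hw x)

lemma ruelle_mono (hF : Continuous F) (hu : Continuous u) (hw : Continuous w)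
    (h : ∀ y, u y ≤ w y) (x : ℕ → M) : ruelle ν F u x ≤ ruelle ν F w x :=
  integral_mono (integrable_ruelle_integrand ν hF hu x) (integrable_ruelle_integrand ν hF hw x)
    fun _ => mul_le_mul_of_nonneg_left (h _) (Real.exp_pos _).le

lemma ruelle_pos (hF : Continuous F) (hu : Continuous u) (h : ∀ y, 0 < u y) (x : ℕ → M) :
    0 < ruelle ν F u x := by
  have hi := integrable_ruelle_integrand ν hF hu x
  have hp : ∀ a, 0 < Real.exp (F (prepend a x)) * u (prepend a x) := fun a =>
    mul_pos (Real.exp_pos _) (h _)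
  refine (integral_pos_iff_support_of_nonneg (fun a => (hp a).le) hi).2 ?_
  have : Function.support (fun a => Real.exp (F (prepend a x)) * u (prepend a x)) = Set.univ :=
    Set.eq_univ_of_forall fun a => (hp a).ne'
  rw [this, measure_univ]
  exact one_pos

end Ruelle

/-! ### Log-Lipschitz cones and the spectral gap. -/

/-- The cone of nonnegative functions whose logarithm is Lipschitz with constant `A`. -/
def LogLipCone {M : Type*} [MetricSpace M] (A : ℝ) (u : (ℕ → M) → ℝ) : Prop :=
  (∀ x, 0 ≤ u x) ∧ ∀ x y, u x ≤ Real.exp (A * seqDist x y) * u y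

section Cone

variable {M : Type*} [MetricSpace M] {A B R : ℝ} {u : (ℕ → M) → ℝ}

/-- From `1 - s ≤ e^{-s}`, the drop from `u x` to `u y` is at most `A d(x,y) u x`. Thus shrinking
the height of a function in a fixed cone shrinks its Lipschitz constant. -/
lemma LogLipCone.hasLip (hA : 0 ≤ A) (hu : LogLipCone A u) (hR : ∀ x, u x ≤ R) :
    HasLip u (A * R) := by
  have key : ∀ x y, u x - u y ≤ A * R * seqDist x y := by
    intro x y
    have h1 := hu.2 x y
    have h2 := Real.add_one_le_exp (-(A * seqDist x y))
    have h3 : Real.exp (-(A * seqDist x y)) * u x ≤ u y := by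
      rw [Real.exp_neg, inv_mul_le_iff₀ (Real.exp_pos _)]
      exact h1
    have h4 := mul_le_mul_of_nonneg_right h2 (hu.1 x)
    have h5 := mul_le_mul_of_nonneg_left (hR x) (mul_nonneg hA (seqDist_nonneg x y))
    linarith
  intro x y
  rw [abs_sub_le_iff]
  exact ⟨key x y, seqDist_comm x y ▸ key y x⟩

/-- Raising `u` by a constant until it is at least `B / A` makes its relative variation at most `A`;
the oscillation of `u`, at most `B`, controls the resulting height. -/
lemma HasLip.logLipCone (hd : ∀ a b : M, dist a b ≤ 1) (hA : 0 < A) (hB : 0 ≤ B)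
    (hu : HasLip u B) (x₀ : ℕ → M) :
    LogLipCone A (fun x => u x - (u x₀ - (B + B / A))) ∧
      ∀ x, u x - (u x₀ - (B + B / A)) ≤ 2 * B + B / A := by
  have hd0 : ∀ x, B / A ≤ u x - (u x₀ - (B + B / A)) := fun x => by
    have := (abs_le.1 (hu.abs_sub_le hd hB x x₀)).1
    linarith
  refine ⟨⟨fun x => (by positivity : 0 ≤ B / A).trans (hd0 x), fun x y => ?_⟩, fun x => ?_⟩
  · have h1 := (abs_le.1 (hu x y)).2
    have h2 := Real.add_one_le_exp (A * seqDist x y)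
    have h3 := mul_le_mul_of_nonneg_right h2 ((by positivity : 0 ≤ B / A).trans (hd0 y))
    have h4 := mul_le_mul_of_nonneg_left (hd0 y) (mul_nonneg hA.le (seqDist_nonneg x y))
    have h5 : A * seqDist x y * (B / A) = B * seqDist x y := by field_simp
    linarith
  · have := (abs_le.1 (hu.abs_sub_le hd hB x x₀)).2
    linarith

end Cone

lemma IsNormalized.ruelle_const {M : Type*} [MetricSpace M] [MeasurableSpace M] {ν : Measure M}
    {f : (ℕ → M) → ℝ} (hf : IsNormalized ν f) (c : ℝ)
    (x : ℕ → M) :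
    ruelle ν f (fun _ => c) x = c := by
  have h := ruelle_const_mul ν (F := f) (u := fun _ => 1) c x
  simp only [mul_one] at h
  rw [h, hf.2 x, mul_one]

lemma IsLip.continuous {M : Type*} [MetricSpace M] {f : (ℕ → M) → ℝ}
    (hd : ∀ a b : M, dist a b ≤ 1) (hf : IsLip f) : Continuous f := by
  obtain ⟨K, hK⟩ := hf
  exact HasLip.continuous hd hK

section Gap

variable {M : Type*} [MetricSpace M] [CompactSpace M] [MeasurableSpace M] [BorelSpace M]
  {ν : Measure M} [IsProbabilityMeasure ν] {f F u w : (ℕ → M) → ℝ} {A B K R S : ℝ}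

/-- Both `e^F` and `u` are compared at points whose distance has been halved, so the log-Lipschitz
constants add and are divided by 2. -/
lemma LogLipCone.map_ruelle (hd : ∀ a b : M, dist a b ≤ 1) (hF : HasLip F K) (huc : Continuous u)
    (hu : LogLipCone A u) : LogLipCone ((K + A) / 2) (ruelle ν F u) := by
  have hFc := hF.continuous hd
  refine ⟨fun x => integral_nonneg fun a => mul_nonneg (Real.exp_pos _).le (hu.1 _),
    fun x y => ?_⟩
  simp only [ruelle, ← integral_const_mul]
  refine integral_mono (integrable_ruelle_integrand ν hFc huc x)
    ((integrable_ruelle_integrand ν hFc huc y).const_mul _) fun a => ?_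
  have h1 := (abs_le.1 (hF (prepend a x) (prepend a y))).2
  have h2 := hu.2 (prepend a x) (prepend a y)
  rw [seqDist_prepend hd] at h1 h2
  have h3 : Real.exp (F (prepend a x)) ≤
      Real.exp (K * (seqDist x y / 2)) * Real.exp (F (prepend a y)) := by
    rw [← Real.exp_add]
    exact Real.exp_le_exp.2 (by linarith)
  have h4 := mul_le_mul h3 h2 (hu.1 _) (by positivity)
  refine h4.trans (le_of_eq ?_)
  have h5 : Real.exp ((K + A) / 2 * seqDist x y) =
      Real.exp (K * (seqDist x y / 2)) * Real.exp (A * (seqDist x y / 2)) := by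
    rw [← Real.exp_add]
    congr 1
    ring
  simp only [h5]
  ring

lemma IsNormalized.ruelle_sub_const (hd : ∀ a b : M, dist a b ≤ 1) (hf : IsNormalized ν f)
    (hu : Continuous u) (c : ℝ) (x : ℕ → M) :
    ruelle ν f (fun y => u y - c) x = ruelle ν f u x - c := by
  rw [ruelle_sub ν (hf.1.continuous hd) hu continuous_const, hf.ruelle_const]

lemma IsNormalized.ruelle_le (hd : ∀ a b : M, dist a b ≤ 1) (hf : IsNormalized ν f)
    (hu : Continuous u) (h : ∀ x, u x ≤ S) (x : ℕ → M) : ruelle ν f u x ≤ S := by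
  have := ruelle_mono ν (hf.1.continuous hd) hu continuous_const h x
  rwa [hf.ruelle_const] at this

lemma IsNormalized.le_ruelle (hd : ∀ a b : M, dist a b ≤ 1) (hf : IsNormalized ν f)
    (hu : Continuous u) (h : ∀ x, S ≤ u x) (x : ℕ → M) : S ≤ ruelle ν f u x := by
  have := ruelle_mono ν (hf.1.continuous hd) continuous_const hu h x
  rwa [hf.ruelle_const] at this

lemma IsNormalized.abs_ruelle_le (hd : ∀ a b : M, dist a b ≤ 1) (hf : IsNormalized ν f)
    (hu : Continuous u) (h : ∀ x, |u x| ≤ S) (x : ℕ → M) : |ruelle ν f u x| ≤ S :=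
  abs_le.2 ⟨hf.le_ruelle hd hu (fun y => (abs_le.1 (h y)).1) x,
    hf.ruelle_le hd hu (fun y => (abs_le.1 (h y)).2) x⟩

/-- One application of a normalized operator, up to a constant, contracts the cone. -/
lemma LogLipCone.exists_ruelle_sub_const (hd : ∀ a b : M, dist a b ≤ 1) (hf : IsNormalized ν f)
    (hK : HasLip f K) (hA : 0 ≤ A) (hKA : 2 * K ≤ A) (huc : Continuous u) (hu : LogLipCone A u)
    (hR : ∀ x, u x ≤ R) (x₀ : ℕ → M) :
    ∃ c, LogLipCone A (fun x => ruelle ν f u x - c) ∧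
      ∀ x, ruelle ν f u x - c ≤ (1 - Real.exp (-2 * A) / 4) * R := by
  set U := ruelle ν f u with hU
  have hcone : LogLipCone ((K + A) / 2) U := hu.map_ruelle hd hK huc
  -- As `K ≤ A / 2`, the new constant `(K + A) / 2` is at most `3A / 4`; the slack up to `A` pays
  -- for subtracting a constant.
  have hcone' : ∀ x y, U x ≤ Real.exp (3 * (A * seqDist x y / 4)) * U y := fun x y =>
    (hcone.2 x y).trans (mul_le_mul_of_nonneg_right (Real.exp_le_exp.2 (by
      have := mul_le_mul_of_nonneg_right hKA (seqDist_nonneg x y)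
      linarith)) (hcone.1 y))
  have hosc : ∀ x y, Real.exp (-A) * U x ≤ U y := fun x y => by
    rw [Real.exp_neg, inv_mul_le_iff₀ (Real.exp_pos _)]
    refine (hcone' x y).trans (mul_le_mul_of_nonneg_right (Real.exp_le_exp.2 ?_) (hcone.1 y))
    have := mul_le_mul_of_nonneg_left (seqDist_le_one hd x y) hA
    linarith
  have hc : ∀ x, Real.exp (-A) * U x₀ / 4 ≤ U x / 4 := fun x => by
    have := hosc x₀ x
    linarith
  -- The subtracted constant is at most a quarter of `U` everywhere, and at least `e^{-2A} / 4`
  -- times any value of `U`, whence the contraction factor.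
  refine ⟨Real.exp (-A) * U x₀ / 4, ⟨fun x => ?_, fun x y => ?_⟩, fun x => ?_⟩
  · have := hc x
    have := hcone.1 x
    linarith
  · set z := Real.exp (A * seqDist x y / 4) with hz
    have hz1 : 1 ≤ z := Real.one_le_exp (by
      have := mul_nonneg hA (seqDist_nonneg x y)
      linarith)
    have e3 : Real.exp (3 * (A * seqDist x y / 4)) = z ^ 3 := by
      rw [hz, ← Real.exp_nat_mul]
      norm_num
    have e4 : Real.exp (A * seqDist x y) = z ^ 4 := by
      rw [hz, ← Real.exp_nat_mul]
      congr 1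
      push_cast
      ring
    have h1 := hcone' x y
    rw [e3] at h1
    simp only [e4]
    have h2 : (z ^ 4 - 1) * (Real.exp (-A) * U x₀ / 4) ≤ (z ^ 4 - 1) * (U y / 4) :=
      mul_le_mul_of_nonneg_left (hc y) (by
        have := one_le_pow₀ hz1 (n := 4)
        linarith)
    -- Equivalent to `3z⁴ - 4z³ + 1 ≥ 0`, which factors as the nonnegative product below.
    have h3 : (z ^ 4 - 1) / 4 ≤ z ^ 4 - z ^ 3 := by
      have : 0 ≤ (z - 1) ^ 2 * (3 * z ^ 2 + 2 * z + 1) := by positivity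
      nlinarith
    have h4 := mul_le_mul_of_nonneg_right h3 (hcone.1 y)
    linarith
  · have h1 := mul_le_mul_of_nonneg_left (hosc x x₀) (Real.exp_pos (-A)).le
    have h2 : Real.exp (-2 * A) = Real.exp (-A) * Real.exp (-A) := by
      rw [← Real.exp_add]
      congr 1
      ring
    have h3 : Real.exp (-2 * A) ≤ 1 := Real.exp_le_one_iff.2 (by linarith)
    have h4 : U x ≤ R := hf.ruelle_le hd huc hR x
    have h5 := mul_le_mul_of_nonneg_left h4 (by linarith : 0 ≤ 1 - Real.exp (-2 * A) / 4)
    rw [h2] at *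
    linarith

lemma continuous_iterate_ruelle (hF : Continuous F) (hu : Continuous u) (n : ℕ) :
    Continuous ((ruelle ν F)^[n] u) := by
  induction n with
  | zero => exact hu
  | succ n ih =>
    rw [Function.iterate_succ_apply']
    exact continuous_ruelle ν hF ih

/-- Spectral gap of a normalized operator for the Lipschitz seminorm. -/
lemma IsNormalized.exists_gap (hd : ∀ a b : M, dist a b ≤ 1) (hf : IsNormalized ν f) (x₀ : ℕ → M) :
    ∃ C θ : ℝ, 0 ≤ C ∧ 0 ≤ θ ∧ θ < 1 ∧ ∀ u B, 0 ≤ B → HasLip u B →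
      ∀ n, HasLip ((ruelle ν f)^[n] u) (C * B * θ ^ n) := by
  obtain ⟨K, hK0, hK⟩ := hf.1.exists_hasLip
  set A := 2 * K + 1
  have hA : 0 < A := by positivity
  set θ := 1 - Real.exp (-2 * A) / 4
  have hθ0 : 0 ≤ θ := by
    have : Real.exp (-2 * A) ≤ 1 := Real.exp_le_one_iff.2 (by linarith)
    simp only [θ]
    linarith
  have hθ1 : θ < 1 := by
    have := Real.exp_pos (-2 * A)
    simp only [θ]
    linarith
  -- The constant is `A` times the initial height: `A * (2 * B + B / A) = (2 * A + 1) * B`.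
  refine ⟨2 * A + 1, θ, by positivity, hθ0, hθ1, fun u B hB hu n => ?_⟩
  have hfc := hf.1.continuous hd
  have huc := hu.continuous hd
  have key : ∃ c, LogLipCone A (fun x => (ruelle ν f)^[n] u x - c) ∧
      ∀ x, (ruelle ν f)^[n] u x - c ≤ θ ^ n * (2 * B + B / A) := by
    induction n with
    | zero =>
      refine ⟨_, (hu.logLipCone hd hA hB x₀).1, fun x => ?_⟩
      simpa using (hu.logLipCone hd hA hB x₀).2 x
    | succ n ih =>
      obtain ⟨c, hc, hR⟩ := ih
      have hcont := continuous_iterate_ruelle (ν := ν) hfc huc n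
      obtain ⟨c', hc', hR'⟩ := LogLipCone.exists_ruelle_sub_const
        (u := fun x => (ruelle ν f)^[n] u x - c) hd hf hK hA.le
        (by simp only [A]; linarith) (hcont.sub continuous_const) hc hR x₀
      simp only [hf.ruelle_sub_const hd hcont] at hc' hR'
      rw [Function.iterate_succ_apply']
      refine ⟨c + c', by simpa only [sub_sub] using hc', fun x => ?_⟩
      have : _ ≤ θ * _ := hR' x
      rw [pow_succ', mul_assoc]
      linarith
  obtain ⟨c, hc, hR⟩ := key
  have h := (hc.hasLip hA.le hR).add_const c
  simp only [sub_add_cancel] at h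
  refine h.mono (le_of_eq ?_)
  field_simp

/-- Inversion of `1 - L` on Lipschitz functions modulo constants. -/
lemma IsNormalized.exists_hasLip_of_sub (hd : ∀ a b : M, dist a b ≤ 1) (hf : IsNormalized ν f)
    (x₀ : ℕ → M) : ∃ C : ℝ, 0 ≤ C ∧ ∀ u b, 0 ≤ b → IsLip u →
      HasLip (fun x => u x - ruelle ν f u x) b → HasLip u (C * b) := by
  obtain ⟨C, θ, hC, hθ0, hθ1, hgap⟩ := hf.exists_gap hd x₀
  have hθ : 0 < 1 - θ := by linarith
  refine ⟨C / (1 - θ), by positivity, fun u b hb hu hub => ?_⟩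
  obtain ⟨B, hB, huB⟩ := hu.exists_hasLip
  have hfc := hf.1.continuous hd
  have huc := huB.continuous hd
  have hdc : Continuous fun x => u x - ruelle ν f u x := huc.sub (continuous_ruelle ν hfc huc)
  -- Neumann series: `u = ∑_{k<n} L^k (u - L u) + L^n u`. The Lipschitz constant of the remainder
  -- tends to 0, so the final bound involves `b` but not the constant of `u`.
  have hiter : ∀ n x, (ruelle ν f)^[n] (fun x => u x - ruelle ν f u x) x =
      (ruelle ν f)^[n] u x - (ruelle ν f)^[n + 1] u x := by
    intro n
    induction n with
    | zero => intro x; rfl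
    | succ n ih =>
      intro x
      rw [Function.iterate_succ_apply', funext ih,
        ruelle_sub ν hfc (continuous_iterate_ruelle hfc huc n)
          (continuous_iterate_ruelle hfc huc (n + 1)),
        Function.iterate_succ_apply' _ (n + 1), Function.iterate_succ_apply' _ n]
  have hsum : ∀ n, HasLip (fun x => u x - (ruelle ν f)^[n] u x)
      (C * b / (1 - θ) * (1 - θ ^ n)) := by
    intro n
    induction n with
    | zero => simpa using HasLip.const (M := M) 0
    | succ n ih =>
      have h := ih.add (hgap _ b hb hub n)
      have e : (fun x => u x - (ruelle ν f)^[n + 1] u x) = fun x => u x - (ruelle ν f)^[n] u x +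
          (ruelle ν f)^[n] (fun x => u x - ruelle ν f u x) x := by
        ext x
        rw [hiter n x]
        ring
      rw [e]
      refine h.mono (le_of_eq ?_)
      field_simp
      ring
  intro x y
  have ht : Filter.Tendsto (fun n : ℕ => (C * b / (1 - θ) * (1 - θ ^ n) + C * B * θ ^ n) *
      seqDist x y) Filter.atTop (nhds ((C * b / (1 - θ) * (1 - 0) + C * B * 0) * seqDist x y)) := by
    have hp := tendsto_pow_atTop_nhds_zero_of_lt_one hθ0 hθ1
    exact (((hp.const_sub 1).const_mul _).add (hp.const_mul _)).mul_const _
  refine (ge_of_tendsto' ht fun n => ?_).trans (le_of_eq (by ring))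
  have := (hsum n).add (hgap u B hB huB n) x y
  simpa using this

end Gap

/-! ### Invariant probabilities of Markov operators. -/

section DualFixed

variable {X : Type*} [TopologicalSpace X] [T2Space X] [CompactSpace X] [MeasurableSpace X]
  [BorelSpace X]

/-- A Markov operator on continuous functions on a compact space has an invariant probability. -/
lemma exists_invariant_of_markov (T : (X → ℝ) → X → ℝ) (x₀ : X)
    (hcont : ∀ u, Continuous u → Continuous (T u))
    (hadd : ∀ u w, Continuous u → Continuous w → ∀ x, T (fun y => u y + w y) x = T u x + T w x)
    (hsmul : ∀ (c : ℝ) u x, T (fun y => c * u y) x = c * T u x)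
    (hnonneg : ∀ u, Continuous u → (∀ x, 0 ≤ u x) → ∀ x, 0 ≤ T u x)
    (hone : ∀ x, T (fun _ => 1) x = 1) :
    ∃ μ : Measure X, IsProbabilityMeasure μ ∧
      ∀ u, Continuous u → ∫ x, T u x ∂μ = ∫ x, u x ∂μ := by
  have itcont : ∀ n u, Continuous u → Continuous (T^[n] u) := fun n u hu => by
    induction n with
    | zero => exact hu
    | succ n ih => rw [Function.iterate_succ_apply']; exact hcont _ ih
  have itadd : ∀ n u w, Continuous u → Continuous w →
      T^[n] (fun y => u y + w y) = fun x => T^[n] u x + T^[n] w x := fun n u w hu hw => by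
    induction n with
    | zero => rfl
    | succ n ih =>
      simp only [Function.iterate_succ_apply', ih]
      exact funext (hadd _ _ (itcont n u hu) (itcont n w hw))
  have itsmul : ∀ n (c : ℝ) u, T^[n] (fun y => c * u y) = fun x => c * T^[n] u x :=
    fun n c u => by
      induction n with
      | zero => rfl
      | succ n ih =>
        simp only [Function.iterate_succ_apply', ih]
        exact funext (hsmul _ _)
  have itnonneg : ∀ n u, Continuous u → (∀ x, 0 ≤ u x) → ∀ x, 0 ≤ T^[n] u x :=
    fun n u hu h => by
      induction n with
      | zero => exact h
      | succ n ih =>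
        rw [Function.iterate_succ_apply']
        exact hnonneg _ (itcont n u hu) ih
  have itone : ∀ n, T^[n] (fun _ => 1) = fun _ => 1 := fun n => by
    induction n with
    | zero => rfl
    | succ n ih => rw [Function.iterate_succ_apply', ih]; exact funext hone
  have itbound : ∀ n u C, Continuous u → (∀ x, |u x| ≤ C) → |T^[n] u x₀| ≤ C := by
    intro n u C hu hC
    have itc : ∀ c : ℝ, T^[n] (fun _ => c) = fun _ => c := fun c => by
      have := itsmul n c (fun _ => 1)
      simpa [itone n] using this
    have h1 := itnonneg n (fun y => C + u y) (continuous_const.add hu)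
      (fun x => by linarith [(abs_le.1 (hC x)).1]) x₀
    have h2 := itnonneg n (fun y => C + -1 * u y) (continuous_const.add (continuous_const.mul hu))
      (fun x => by linarith [(abs_le.1 (hC x)).2]) x₀
    rw [itadd n (fun _ => C) u continuous_const hu, itc] at h1
    rw [itadd n (fun _ => C) (fun y => -1 * u y) continuous_const
      (continuous_const.mul hu), itc, itsmul] at h2
    exact abs_le.2 ⟨by linarith, by linarith⟩
  -- Krylov–Bogolyubov: a limit of these Cesàro averages is a positive functional, represented by a
  -- measure. Taking the limit along one ultrafilter makes it exist for all continuous `u` at once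
  -- and depend linearly on `u`.
  let avg : (X → ℝ) → ℕ → ℝ := fun u n => (∑ k ∈ Finset.range (n + 1), T^[k] u x₀) / (n + 1)
  have avgbound : ∀ u C, Continuous u → (∀ x, |u x| ≤ C) → ∀ n, |avg u n| ≤ C := by
    intro u C hu hC n
    have hn : (0 : ℝ) < n + 1 := by positivity
    rw [abs_div, abs_of_pos hn, div_le_iff₀ hn]
    refine (Finset.abs_sum_le_sum_abs _ _).trans ?_
    refine (Finset.sum_le_sum fun k _ => itbound k u C hu hC).trans ?_
    simp [mul_comm]
  have hlim : ∀ u, Continuous u → ∃ l, Tendsto (avg u) (hyperfilter ℕ) (𝓝 l) := by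
    intro u hu
    obtain ⟨C, -, hC⟩ := exists_abs_le hu
    have hmem : ∀ n, avg u n ∈ Set.Icc (-C) C := fun n => abs_le.1 (avgbound u C hu hC n)
    obtain ⟨l, -, hl⟩ := (isCompact_Icc (a := -C) (b := C)).ultrafilter_le_nhds
      ((hyperfilter ℕ).map (avg u))
        (tendsto_principal.2 (Eventually.of_forall hmem))
    exact ⟨l, hl⟩
  choose! l hl using hlim
  have uniq : ∀ {s : ℕ → ℝ} {a b : ℝ}, Tendsto s (hyperfilter ℕ) (𝓝 a) →
      Tendsto s (hyperfilter ℕ) (𝓝 b) → a = b := fun h h' => tendsto_nhds_unique h h'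
  let lin : CompactlySupportedContinuousMap X ℝ →ₗ[ℝ] ℝ :=
    { toFun := fun u => l u
      map_add' := fun u w => by
        refine uniq (hl _ (u + w).continuous) (((hl u u.continuous).add
          (hl w w.continuous)).congr fun n => ?_)
        have e : (⇑(u + w)) = fun y => u y + w y := rfl
        simp only [avg, e, itadd _ u w u.continuous w.continuous, Finset.sum_add_distrib, add_div]
      map_smul' := fun c u => by
        refine uniq (hl _ (c • u).continuous) (((hl u u.continuous).const_mul c).congr fun n => ?_)
        have e : (⇑(c • u)) = fun y => c * u y := rfl
        simp only [avg, e, itsmul, ← Finset.mul_sum, mul_div_assoc] }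
  let Λ := PositiveLinearMap.mk₀ lin fun u hu => by
    refine ge_of_tendsto' (hl u u.continuous) fun n => ?_
    exact div_nonneg (Finset.sum_nonneg fun k _ => itnonneg k u u.continuous hu x₀) (by positivity)
  let cc : ∀ u : X → ℝ, Continuous u → CompactlySupportedContinuousMap X ℝ := fun u hu =>
    CompactlySupportedContinuousMap.continuousMapEquiv ⟨u, hu⟩
  have hint : ∀ u, Continuous u → ∫ x, u x ∂(RealRMK.rieszMeasure Λ) = l u := fun u hu =>
    RealRMK.integral_rieszMeasure Λ (cc u hu)
  refine ⟨RealRMK.rieszMeasure Λ, ⟨?_⟩, fun u hu => ?_⟩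
  · have h1 := hint (fun _ => 1) continuous_const
    have h2 : l (fun _ => 1) = 1 := uniq (hl _ continuous_const)
      (tendsto_const_nhds.congr fun n => by
        have : (n : ℝ) + 1 ≠ 0 := by positivity
        simp [avg, itone, this])
    rw [h2] at h1
    simpa [Measure.real, ENNReal.toReal_eq_one_iff] using h1
  · rw [hint _ (hcont u hu), hint u hu]
    obtain ⟨C, -, hC⟩ := exists_abs_le hu
    -- The two averages telescope to a bounded quantity divided by `n + 1`.
    have hz : Tendsto (fun n => avg (T u) n - avg u n) atTop (𝓝 0) := by
      have e : ∀ n, avg (T u) n - avg u n = (T^[n + 1] u x₀ - u x₀) / (n + 1) := fun n => by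
        simp only [avg, ← sub_div, ← Finset.sum_sub_distrib, ← Function.iterate_succ_apply]
        rw [Finset.sum_range_sub (fun k => T^[k] u x₀)]
        rfl
      refine squeeze_zero_norm (a := fun n : ℕ => 2 * C * (1 / ((n : ℝ) + 1))) (fun n => ?_) ?_
      · have hn : (0 : ℝ) < n + 1 := by positivity
        rw [e, Real.norm_eq_abs, abs_div, abs_of_pos hn, mul_one_div]
        refine div_le_div_of_nonneg_right ((abs_sub _ _).trans ?_) hn.le
        linarith [itbound (n + 1) u C hu hC, hC x₀]
      · simpa using tendsto_one_div_add_atTop_nhds_zero_nat.const_mul (2 * C)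
    have := uniq ((hl _ (hcont u hu)).sub (hl u hu)) (hz.mono_left Nat.hyperfilter_le_atTop)
    linarith

end DualFixed

section Gibbs

variable {M : Type*} [MetricSpace M] [CompactSpace M] [MeasurableSpace M] [BorelSpace M]
  {ν : Measure M} [IsProbabilityMeasure ν] {F : (ℕ → M) → ℝ}

lemma exists_isDualFixed (hF : Continuous F) (h1 : ∀ x, ruelle ν F (fun _ => 1) x = 1)
    (x₀ : ℕ → M) : ∃ μ : Measure (ℕ → M), IsProbabilityMeasure μ ∧ IsDualFixed ν F μ := by
  have : BorelSpace (ℕ → M) := Pi.borelSpace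
  exact exists_invariant_of_markov (ruelle ν F) x₀ (fun u hu => continuous_ruelle ν hF hu)
    (fun u w hu hw x => ruelle_add ν hF hu hw x) (fun c u x => ruelle_const_mul ν c x)
    (fun u hu h x => integral_nonneg fun a => mul_nonneg (Real.exp_pos _).le (h _)) h1

end Gibbs

/-! ### Existence of positive eigenfunctions. -/

/-- The logarithmic form `u ↦ log (L_F (exp u))` of the Ruelle operator. -/
noncomputable def logRuelle {M : Type*} [MeasurableSpace M] (ν : Measure M)
    (F u : (ℕ → M) → ℝ) (x : ℕ → M) : ℝ :=
  Real.log (ruelle ν F (fun y => Real.exp (u y)) x)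

lemma HasLip.logLipCone_exp {M : Type*} [MetricSpace M] {u : (ℕ → M) → ℝ} {B : ℝ}
    (hu : HasLip u B) : LogLipCone B fun x => Real.exp (u x) :=
  ⟨fun x => (Real.exp_pos _).le, fun x y => by
    rw [← Real.exp_add]
    exact Real.exp_le_exp.2 (by linarith [(abs_le.1 (hu x y)).2])⟩

section LogRuelle

variable {M : Type*} [MetricSpace M] [CompactSpace M] [MeasurableSpace M] [BorelSpace M]
  {ν : Measure M} [IsProbabilityMeasure ν] {F u w : (ℕ → M) → ℝ} {B K C : ℝ}

lemma ruelle_exp_pos (hF : Continuous F) (hu : Continuous u) (x : ℕ → M) :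
    0 < ruelle ν F (fun y => Real.exp (u y)) x :=
  ruelle_pos ν hF (Real.continuous_exp.comp hu) (fun _ => Real.exp_pos _) x

lemma continuous_logRuelle (hF : Continuous F) (hu : Continuous u) :
    Continuous (logRuelle ν F u) :=
  (continuous_ruelle ν hF (Real.continuous_exp.comp hu)).log
    fun x => (ruelle_exp_pos hF hu x).ne'

lemma logRuelle_add_const (hF : Continuous F) (hu : Continuous u) (c : ℝ) (x : ℕ → M) :
    logRuelle ν F (fun y => u y + c) x = logRuelle ν F u x + c := by
  have h : (fun y => Real.exp (u y + c)) = fun y => Real.exp c * Real.exp (u y) := by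
    ext y
    rw [Real.exp_add, mul_comm]
  rw [logRuelle, h, ruelle_const_mul, Real.log_mul (Real.exp_pos c).ne'
    (ruelle_exp_pos hF hu x).ne', Real.log_exp, add_comm, logRuelle]

lemma logRuelle_mono (hF : Continuous F) (hu : Continuous u) (hw : Continuous w)
    (h : ∀ y, u y ≤ w y) (x : ℕ → M) : logRuelle ν F u x ≤ logRuelle ν F w x :=
  Real.log_le_log (ruelle_exp_pos hF hu x) (ruelle_mono ν hF (Real.continuous_exp.comp hu)
    (Real.continuous_exp.comp hw) (fun y => Real.exp_le_exp.2 (h y)) x)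

/-- A monotone map commuting with the addition of constants is nonexpansive in the sup norm. -/
lemma abs_logRuelle_sub_le (hF : Continuous F) (hu : Continuous u) (hw : Continuous w)
    (h : ∀ y, |u y - w y| ≤ C) (x : ℕ → M) : |logRuelle ν F u x - logRuelle ν F w x| ≤ C := by
  have h1 := logRuelle_mono (ν := ν) hF hu (w := fun y => w y + C) (hw.add continuous_const)
    (fun y => by linarith [(abs_le.1 (h y)).2] : ∀ y, u y ≤ w y + C) x
  have h2 := logRuelle_mono (ν := ν) hF hw (w := fun y => u y + C) (hu.add continuous_const)
    (fun y => by linarith [(abs_le.1 (h y)).1] : ∀ y, w y ≤ u y + C) x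
  rw [logRuelle_add_const hF hw] at h1
  rw [logRuelle_add_const hF hu] at h2
  exact abs_le.2 ⟨by linarith, by linarith⟩

lemma HasLip.map_logRuelle (hd : ∀ a b : M, dist a b ≤ 1) (hF : HasLip F K) (hu : HasLip u B) :
    HasLip (logRuelle ν F u) ((K + B) / 2) := by
  have hFc := hF.continuous hd
  have huc := hu.continuous hd
  have hc := (hu.logLipCone_exp.map_ruelle (ν := ν) (u := fun x => Real.exp (u x)) hd hF
    (Real.continuous_exp.comp huc)).2
  have key : ∀ x y, logRuelle ν F u x - logRuelle ν F u y ≤ (K + B) / 2 * seqDist x y := by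
    intro x y
    have h := Real.log_le_log (ruelle_exp_pos hFc huc x) (hc x y)
    rw [Real.log_mul (Real.exp_pos _).ne' (ruelle_exp_pos hFc huc y).ne', Real.log_exp] at h
    simp only [logRuelle]
    linarith
  intro x y
  rw [abs_sub_le_iff]
  exact ⟨key x y, seqDist_comm x y ▸ key y x⟩

lemma abs_logRuelle_zero_le (hF : Continuous F) (h : ∀ y, |F y| ≤ C) (x : ℕ → M) :
    |logRuelle ν F (fun _ => 0) x| ≤ C := by
  have hi := integrable_ruelle_integrand ν hF (u := fun _ => Real.exp 0) continuous_const x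
  have h1 : Real.exp (-C) ≤ ruelle ν F (fun _ => Real.exp 0) x := by
    have := integral_mono (integrable_const (Real.exp (-C))) hi fun a => by
      simpa using (abs_le.1 (h (prepend a x))).1
    simpa [ruelle] using this
  have h2 : ruelle ν F (fun _ => Real.exp 0) x ≤ Real.exp C := by
    have := integral_mono hi (integrable_const (Real.exp C)) fun a => by
      simpa using (abs_le.1 (h (prepend a x))).2
    simpa [ruelle] using this
  refine abs_le.2 ⟨?_, ?_⟩
  · rw [← Real.log_exp (-C)]
    exact Real.log_le_log (Real.exp_pos _) h1
  · rw [← Real.log_exp C]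
    exact Real.log_le_log ((Real.exp_pos _).trans_le h1) h2

/-- The discounted equation `u = log L_F (exp (s u))` has a Lipschitz solution. -/
lemma exists_discounted_fixedPoint (hd : ∀ a b : M, dist a b ≤ 1) (hK : 0 ≤ K) (hF : HasLip F K)
    (hC : ∀ y, |F y| ≤ C) (hC0 : 0 ≤ C) {s : ℝ} (hs0 : 0 ≤ s) (hs1 : s < 1) :
    ∃ u, HasLip u K ∧ (∀ x, (1 - s) * |u x| ≤ C) ∧
      ∀ x, u x = logRuelle ν F (fun y => s * u y) x := by
  have hFc := hF.continuous hd
  have hsc : ∀ u : (ℕ → M) →ᵇ ℝ, Continuous fun y => s * u y := fun u =>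
    continuous_const.mul u.continuous
  let T : ((ℕ → M) →ᵇ ℝ) → ((ℕ → M) →ᵇ ℝ) := fun u =>
    BoundedContinuousFunction.mkOfCompact ⟨logRuelle ν F fun y => s * u y,
      continuous_logRuelle hFc (hsc u)⟩
  have hT : ∀ u x, T u x = logRuelle ν F (fun y => s * u y) x := fun u x => rfl
  have hcontr : ContractingWith ⟨s, hs0⟩ T := by
    refine ⟨by exact_mod_cast hs1, LipschitzWith.of_dist_le_mul fun u w => ?_⟩
    refine (BoundedContinuousFunction.dist_le (mul_nonneg hs0 dist_nonneg)).2 fun x => ?_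
    refine abs_logRuelle_sub_le hFc (hsc u) (hsc w) (fun y => ?_) x
    rw [← mul_sub, abs_mul, abs_of_nonneg hs0]
    exact mul_le_mul_of_nonneg_left (u.dist_coe_le_dist (g := w) y) hs0
  set u := ContractingWith.fixedPoint T hcontr with hu
  have hfix : T u = u := hcontr.fixedPoint_isFixedPt
  refine ⟨u, fun x y => ?_, fun x => ?_, fun x => by rw [← hT, hfix]⟩
  -- The bound `K` is stable since `(K + s K) / 2 ≤ K`. Its independence of `s` provides the
  -- compactness needed as `s → 1`.
  · have hit : ∀ n, HasLip (T^[n] 0) K := by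
      intro n
      induction n with
      | zero => exact (HasLip.const 0).mono hK
      | succ n ih =>
        rw [Function.iterate_succ_apply']
        refine (HasLip.map_logRuelle (ν := ν) hd hF (ih.const_mul s)).mono ?_
        rw [abs_of_nonneg hs0]
        nlinarith
    have ht := hcontr.tendsto_iterate_fixedPoint 0
    have htx : ∀ x, Tendsto (fun n => (T^[n] 0) x) atTop (𝓝 (u x)) := fun x =>
      ((BoundedContinuousFunction.lipschitz_eval_const x).continuous.tendsto _).comp ht
    exact le_of_tendsto' ((htx x).sub (htx y)).abs fun n => hit n x y
  · have hn : ‖u‖ ≤ C + s * ‖u‖ := by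
      refine (BoundedContinuousFunction.norm_le (by positivity)).2 fun y => ?_
      have h1 := abs_logRuelle_sub_le (ν := ν) hFc (hsc u) continuous_const (C := s * ‖u‖)
        (w := fun _ => 0) (fun z => by
          rw [sub_zero, abs_mul, abs_of_nonneg hs0]
          exact mul_le_mul_of_nonneg_left (u.norm_coe_le_norm z) hs0) y
      have h2 := abs_logRuelle_zero_le (ν := ν) hFc hC y
      rw [← hT, hfix] at h1
      rw [Real.norm_eq_abs]
      have := abs_sub_abs_le_abs_sub (u y) (logRuelle ν F (fun _ => 0) y)
      linarith
    have h3 : |u x| ≤ ‖u‖ := u.norm_coe_le_norm x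
    nlinarith

/-- Arzelà–Ascoli; used to extract a limit of the discounted solutions. -/
lemma isCompact_hasLip {M : Type*} [MetricSpace M] [CompactSpace M] (hd : ∀ a b : M, dist a b ≤ 1) (K C : ℝ) :
    IsCompact {u : (ℕ → M) →ᵇ ℝ | HasLip u K ∧ ∀ x, u x ∈ Set.Icc (-C) C} := by
  refine BoundedContinuousFunction.arzela_ascoli₂ (Set.Icc (-C) C) isCompact_Icc _ ?_
    (fun u x hu => hu.2 x) ?_
  · have hc : ∀ x : ℕ → M, Continuous fun u : (ℕ → M) →ᵇ ℝ => u x := fun x =>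
      (BoundedContinuousFunction.lipschitz_eval_const x).continuous
    simp only [HasLip, Set.ofPred_and, Set.ofPred_forall]
    refine IsClosed.inter ?_ (isClosed_iInter fun x => isClosed_Icc.preimage (hc x))
    exact isClosed_iInter fun x => isClosed_iInter fun y =>
      isClosed_le ((hc x).sub (hc y)).abs continuous_const
  · intro x
    rw [Metric.equicontinuousAt_iff_right]
    intro ε hε
    have hc : Continuous fun y : ℕ → M => K * seqDist x y :=
      continuous_const.mul ((continuous_seqDist hd).comp (by fun_prop :
        Continuous fun y : ℕ → M => (x, y)))
    have ht : Tendsto (fun y => K * seqDist x y) (𝓝 x) (𝓝 0) := by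
      simpa [seqDist_self] using hc.tendsto x
    filter_upwards [ht.eventually_lt_const hε] with y hy
    intro u
    exact (u.2.1 x y).trans_lt hy

/-- Ruelle's theorem, existence part: a Lipschitz potential has a positive Lipschitz
eigenfunction. -/
lemma exists_isPosEigenpair (hd : ∀ a b : M, dist a b ≤ 1) (hF : IsLip F) (x₀ : ℕ → M) :
    ∃ lam h, IsPosEigenpair ν F lam h := by
  obtain ⟨K, hK, hFK⟩ := hF.exists_hasLip
  have hFc := hFK.continuous hd
  obtain ⟨C, hC0, hC⟩ := exists_abs_le hFc
  have hs0 : ∀ n : ℕ, (0 : ℝ) ≤ 1 - 1 / ((n : ℝ) + 1) := fun n => by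
    have : 1 / ((n : ℝ) + 1) ≤ 1 := (div_le_one (by positivity)).2 (by
      have : (0 : ℝ) ≤ n := n.cast_nonneg
      linarith)
    linarith
  have hs1 : ∀ n : ℕ, 1 - 1 / ((n : ℝ) + 1) < 1 := fun n => by
    have : 0 < 1 / ((n : ℝ) + 1) := by positivity
    linarith
  choose u huK huC hu using fun n : ℕ =>
    exists_discounted_fixedPoint (ν := ν) hd hK hFK hC hC0 (hs0 n) (hs1 n)
  set s : ℕ → ℝ := fun n => 1 - 1 / ((n : ℝ) + 1) with hs
  have huc : ∀ n, Continuous (u n) := fun n => (huK n).continuous hd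
  -- The solutions `u n` may blow up as `s n → 1`, but their oscillation stays at most `K` and `(1 -
  -- s n) * u n x₀` stays bounded by `C`. The limit of the latter is the logarithm of the
  -- eigenvalue.
  let U : ℕ → (ℕ → M) →ᵇ ℝ := fun n => BoundedContinuousFunction.mkOfCompact
    ⟨fun x => u n x - u n x₀, (huc n).sub continuous_const⟩
  have hU : ∀ n x, U n x = u n x - u n x₀ := fun n x => rfl
  let c : ℕ → ℝ := fun n => (1 - s n) * u n x₀
  obtain ⟨⟨v, a⟩, ⟨⟨hvK, hvb⟩, -⟩, k, hk, hlim⟩ :=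
    ((isCompact_hasLip hd K K).prod (isCompact_Icc (a := -C) (b := C))).tendsto_subseq
      (x := fun n => (U n, c n)) fun n => by
        refine ⟨⟨(huK n).sub_const _, fun x => abs_le.1 ((huK n).abs_sub_le hd hK x x₀)⟩, ?_⟩
        refine abs_le.1 ?_
        have h := huC n x₀
        rwa [← abs_of_pos (sub_pos.2 (hs1 n)), ← abs_mul] at h
  have hlimU : Tendsto (fun n => U (k n)) atTop (𝓝 v) := (continuous_fst.tendsto _).comp hlim
  have hlimc : Tendsto (fun n => c (k n)) atTop (𝓝 a) := (continuous_snd.tendsto _).comp hlim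
  have hlims : Tendsto (fun n => s (k n)) atTop (𝓝 1) := by
    have : Tendsto s atTop (𝓝 (1 - 0)) := tendsto_one_div_add_atTop_nhds_zero_nat.const_sub 1
    rw [sub_zero] at this
    exact this.comp hk.tendsto_atTop
  have heq : ∀ n x, U n x + c n = logRuelle ν F (fun y => s n * U n y) x := by
    intro n x
    have h := logRuelle_add_const (ν := ν) (u := fun y => s n * U n y) hFc
      (continuous_const.mul (U n).continuous) (s n * u n x₀) x
    have e : (fun y => s n * U n y + s n * u n x₀) = fun y => s n * u n y := by
      ext y
      rw [hU]
      ring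
    rw [e, ← hu n x] at h
    rw [hU]
    simp only [c]
    linarith
  have hdist : Tendsto (fun n => ‖s (k n) • U (k n) - v‖) atTop (𝓝 0) := by
    have h := (hlims.smul hlimU).sub_const v
    rw [one_smul, sub_self] at h
    simpa using h.norm
  have hfix : ∀ x, v x + a = logRuelle ν F v x := by
    intro x
    have h1 : Tendsto (fun n => U (k n) x + c (k n)) atTop (𝓝 (v x + a)) :=
      (((BoundedContinuousFunction.lipschitz_eval_const x).continuous.tendsto _).comp hlimU).add hlimc
    refine tendsto_nhds_unique h1 (tendsto_iff_norm_sub_tendsto_zero.2 ?_)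
    refine squeeze_zero (fun _ => norm_nonneg _) (fun n => ?_) hdist
    rw [heq]
    exact abs_logRuelle_sub_le hFc (continuous_const.mul (U (k n)).continuous) v.continuous
      (fun y => (s (k n) • U (k n) - v).norm_coe_le_norm y) x
  refine ⟨Real.exp a, fun x => Real.exp (v x), Real.exp_pos _, ?_, fun x => Real.exp_pos _,
    fun x => ?_⟩
  · exact (hvK.logLipCone_exp.hasLip hK fun x => Real.exp_le_exp.2 (hvb x).2).isLip
  · have h := congrArg Real.exp (hfix x)
    rw [logRuelle, Real.exp_log (ruelle_exp_pos hFc v.continuous x), Real.exp_add] at h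
    rw [← h, mul_comm]

end LogRuelle

/-! ### Regularity of transfer functions. -/

section Coboundary

variable {M : Type*}

lemma iterate_prepend_apply (a : M) (x : ℕ → M) (n m : ℕ) (h : m < n) :
    (prepend a)^[n] x m = a := by
  induction n generalizing m with
  | zero => omega
  | succ n ih =>
    rw [Function.iterate_succ_apply']
    cases m with
    | zero => rfl
    | succ m => exact ih m (by omega)

/-- A continuous transfer function of a Lipschitz coboundary is Lipschitz. -/
lemma HasLip.of_coboundary [MetricSpace M] (hd : ∀ a b : M, dist a b ≤ 1) {v : (ℕ → M) → ℝ}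
    {G : ℝ} (hv : Continuous v) (h : HasLip (fun x => v x - v (shift x)) G) : HasLip v G := by
  intro x y
  -- Repeatedly prepending one symbol sends both points to the same constant sequence. Along the way
  -- the coboundary differences cost `∑_{k≥1} 2^{-k} G d(x,y) = G d(x,y)`.
  set P := prepend (x 0) with hP
  have hdist : ∀ n, seqDist (P^[n] x) (P^[n] y) = (1 / 2) ^ n * seqDist x y := by
    intro n
    induction n with
    | zero => simp
    | succ n ih =>
      rw [Function.iterate_succ_apply', Function.iterate_succ_apply', hP, seqDist_prepend hd, ← hP,
        ih]
      ring
  have hn : ∀ n, |v x - v y| ≤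
      |v (P^[n] x) - v (P^[n] y)| + G * seqDist x y * (1 - (1 / 2) ^ n) := by
    intro n
    induction n with
    | zero => simp
    | succ n ih =>
      have h1 := h (P^[n + 1] x) (P^[n + 1] y)
      rw [hdist] at h1
      simp only [Function.iterate_succ_apply', hP, shift_prepend] at h1
      simp only [Function.iterate_succ_apply']
      rw [← hP] at h1
      have h2 := abs_sub_abs_le_abs_sub (v (P^[n] x) - v (P^[n] y))
        (v (P (P^[n] x)) - v (P (P^[n] y)))
      have e : v (P^[n] x) - v (P^[n] y) - (v (P (P^[n] x)) - v (P (P^[n] y))) =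
        -(v (P (P^[n] x)) - v (P^[n] x) - (v (P (P^[n] y)) - v (P^[n] y))) := by ring
      rw [e, abs_neg] at h2
      rw [pow_succ] at *
      linarith
  have hlim : ∀ z : ℕ → M, Tendsto (fun n => v (P^[n] z)) atTop (𝓝 (v fun _ => x 0)) := by
    intro z
    refine (hv.tendsto _).comp (tendsto_pi_nhds.2 fun m => ?_)
    refine tendsto_const_nhds.congr' ?_
    filter_upwards [eventually_gt_atTop m] with n hn
    exact (iterate_prepend_apply (x 0) z n m hn).symm
  have ht := ((hlim x).sub (hlim y)).abs.add
    (((tendsto_pow_atTop_nhds_zero_of_lt_one (r := (1 / 2 : ℝ)) (by norm_num)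
      (by norm_num)).const_sub 1).const_mul (G * seqDist x y))
  refine (ge_of_tendsto' ht hn).trans (le_of_eq ?_)
  simp

end Coboundary

/-! ### Exponential bounds and perturbation of the eigendata. -/

section Scalar

lemma abs_exp_sub_exp_le {s a b : ℝ} (ha : |a| ≤ s) (hb : |b| ≤ s) :
    |Real.exp a - Real.exp b| ≤ Real.exp s * |a - b| :=
  (convex_Icc (-s) s).norm_image_sub_le_of_norm_deriv_le
    (fun x _ => Real.differentiableAt_exp) (fun x hx => by
      rw [Real.deriv_exp, Real.norm_of_nonneg (Real.exp_pos x).le]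
      exact Real.exp_le_exp.2 hx.2) (abs_le.1 hb) (abs_le.1 ha)

lemma abs_exp_sub_one_le {s a : ℝ} (ha : |a| ≤ s) : |Real.exp a - 1| ≤ Real.exp s * |a| := by
  simpa using abs_exp_sub_exp_le ha (b := 0) (by simpa using (abs_nonneg a).trans ha)

lemma abs_exp_remainder_sub_le {s a b : ℝ} (ha : |a| ≤ s) (hb : |b| ≤ s) :
    |(Real.exp a - 1 - a) - (Real.exp b - 1 - b)| ≤ s * Real.exp s * |a - b| := by
  refine (convex_Icc (-s) s).norm_image_sub_le_of_norm_deriv_le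
    (f := fun x => Real.exp x - 1 - x) (fun x _ => by fun_prop) (fun x hx => ?_)
    (abs_le.1 hb) (abs_le.1 ha)
  have hder : HasDerivAt (fun x => Real.exp x - 1 - x) (Real.exp x - 1) x :=
    ((Real.hasDerivAt_exp x).sub_const 1).sub (hasDerivAt_id x)
  rw [hder.deriv, Real.norm_eq_abs, mul_comm]
  exact (abs_exp_sub_one_le (abs_le.2 hx)).trans
    (mul_le_mul_of_nonneg_left (abs_le.2 hx) (Real.exp_pos s).le)

lemma abs_exp_remainder_le {s a : ℝ} (ha : |a| ≤ s) :
    |Real.exp a - 1 - a| ≤ s * Real.exp s * |a| := by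
  simpa using abs_exp_remainder_sub_le ha (b := 0) (by simpa using (abs_nonneg a).trans ha)

end Scalar

section Perturbation

variable {M : Type*} [MetricSpace M] [CompactSpace M] [MeasurableSpace M] [BorelSpace M]
  {ν : Measure M} [IsProbabilityMeasure ν] {f η : (ℕ → M) → ℝ}

/-- The eigenvalue of a perturbed normalized operator is close to `1`. -/
lemma IsNormalized.abs_eigenvalue_sub_one_le (hd : ∀ a b : M, dist a b ≤ 1)
    (hf : IsNormalized ν f) {p k : (ℕ → M) → ℝ} {lam s : ℝ} (hlam : 0 < lam) (hp : Continuous p)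
    (hps : ∀ x, |p x| ≤ s) (hk : Continuous k) (hk0 : ∀ x, 0 < k x)
    (heig : ∀ x, ruelle ν f (fun y => Real.exp (p y) * k y) x = lam * k x) (x₀ : ℕ → M) :
    |lam - 1| ≤ Real.exp s * s := by
  have hc : Continuous fun y => Real.exp (p y) * k y := (Real.continuous_exp.comp hp).mul hk
  -- Maximum principle: the eigenvalue equation at a maximum and at a minimum of `k` gives `e^{-s} ≤
  -- lam ≤ e^s`.
  obtain ⟨xM, -, hM⟩ := isCompact_univ.exists_isMaxOn ⟨x₀, trivial⟩ hk.continuousOn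
  obtain ⟨xm, -, hm⟩ := isCompact_univ.exists_isMinOn ⟨x₀, trivial⟩ hk.continuousOn
  have h1 : lam ≤ Real.exp s := by
    have := hf.ruelle_le hd hc (S := Real.exp s * k xM) (fun x =>
      mul_le_mul (Real.exp_le_exp.2 (abs_le.1 (hps x)).2) (hM trivial) (hk0 x).le
        (Real.exp_pos s).le) xM
    rw [heig] at this
    exact le_of_mul_le_mul_right this (hk0 xM)
  have h2 : Real.exp (-s) ≤ lam := by
    have := hf.le_ruelle hd hc (S := Real.exp (-s) * k xm) (fun x =>
      mul_le_mul (Real.exp_le_exp.2 (abs_le.1 (hps x)).1) (hm trivial) (hk0 xm).le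
        (Real.exp_pos _).le) xm
    rw [heig] at this
    exact le_of_mul_le_mul_right this (hk0 xm)
  have h3 : |Real.log lam| ≤ s := abs_le.2
    ⟨(Real.le_log_iff_exp_le hlam).2 h2, (Real.log_le_iff_le_exp hlam).2 h1⟩
  have h4 := abs_exp_sub_one_le h3
  rw [Real.exp_log hlam] at h4
  exact h4.trans (mul_le_mul_of_nonneg_left h3 (Real.exp_pos s).le)

/-- If `L_f η = 0`, then the eigendata of `L_{f + t η}` are constant up to `O(t ^ 2)`. -/
lemma IsNormalized.exists_eigen_estimate (hd : ∀ a b : M, dist a b ≤ 1) (hf : IsNormalized ν f)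
    (hη : η ∈ ruelleKer ν f) (x₀ : ℕ → M) :
    ∃ C t₀ : ℝ, 0 ≤ C ∧ 0 < t₀ ∧ ∀ t lam k, |t| ≤ t₀ → 0 < lam → IsLip k → (∀ x, 0 < k x) →
      (∀ x, ruelle ν f (fun y => Real.exp (t * η y) * k y) x = lam * k x) → k x₀ = 1 →
      HasLip k (C * t ^ 2) ∧ |lam - 1| ≤ C * t ^ 2 := by
  obtain ⟨E₁, hE₁, hηE₁⟩ := hη.1.exists_hasLip
  have hηc := hηE₁.continuous hd
  obtain ⟨E₂, hE₂, hηE₂⟩ := exists_abs_le hηc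
  set E := max E₁ E₂
  have hE : 0 ≤ E := hE₁.trans (le_max_left _ _)
  have hηE : HasLip η E := hηE₁.mono (le_max_left _ _)
  have hηb : ∀ x, |η x| ≤ E := fun x => (hηE₂ x).trans (le_max_right _ _)
  obtain ⟨C₀, θ, hC₀, hθ0, hθ1, hgap⟩ := hf.exists_gap hd x₀
  obtain ⟨C₂, hC₂, hinv⟩ := hf.exists_hasLip_of_sub hd x₀
  set C₁ := C₀ * θ
  have hC₁ : 0 ≤ C₁ := mul_nonneg hC₀ hθ0
  have hL : ∀ u B, 0 ≤ B → HasLip u B → HasLip (ruelle ν f u) (C₁ * B) := fun u B hB hu =>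
    (hgap u B hB hu 1).mono (le_of_eq (by simp only [C₁]; ring))
  set Q := E * Real.exp E
  have hQ : 0 ≤ Q := by positivity
  set Q' := E * E * Real.exp E
  have hQ' : 0 ≤ Q' := by positivity
  set a := C₂ * (2 * C₁ + 1) * Q
  have ha : 0 ≤ a := by positivity
  have hfc := hf.1.continuous hd
  refine ⟨2 * (C₂ * C₁ * Q') * (1 + Q) + Q', min 1 (1 / (2 * (a + 1))), by positivity,
    lt_min one_pos (by positivity), fun t lam k ht hlam hk hk0 heig hk1 => ?_⟩
  have ht1 : |t| ≤ 1 := ht.trans (min_le_left _ _)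
  have hat : a * |t| ≤ 1 / 2 := by
    have h1 : |t| ≤ 1 / (2 * (a + 1)) := ht.trans (min_le_right _ _)
    rw [le_div_iff₀ (by positivity)] at h1
    nlinarith [abs_nonneg t]
  have ht2 : |t| * |t| = t ^ 2 := by rw [abs_mul_abs_self, sq]
  have hkc := hk.continuous hd
  set s := |t| * E
  have hs0 : 0 ≤ s := by positivity
  have hsE : s ≤ E := mul_le_of_le_one_left hE ht1
  have hes : Real.exp s ≤ Real.exp E := Real.exp_le_exp.2 hsE
  have hbs : ∀ x, |t * η x| ≤ s := fun x => by
    rw [abs_mul]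
    exact mul_le_mul_of_nonneg_left (hηb x) (abs_nonneg t)
  have htη : HasLip (fun x => t * η x) s := hηE.const_mul t
  have hesE : Real.exp s * s ≤ |t| * Q := by
    have := mul_le_mul_of_nonneg_right hes hs0
    simp only [s, Q] at *
    linarith
  have hesE2 : s * Real.exp s * s ≤ t ^ 2 * Q' := by
    have := mul_le_mul_of_nonneg_left hesE hs0
    have e : s * (|t| * Q) = t ^ 2 * Q' := by
      rw [← ht2]
      simp only [s, Q, Q']
      ring
    linarith
  set m : (ℕ → M) → ℝ := fun x => Real.exp (t * η x) - 1 with hm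
  set R : (ℕ → M) → ℝ := fun x => Real.exp (t * η x) - 1 - t * η x with hR
  have hmL : HasLip m (|t| * Q) := ((htη.comp (F := fun z => Real.exp z - 1) (Real.exp_pos s).le
    fun x y => by simpa using abs_exp_sub_exp_le (hbs x) (hbs y))).mono hesE
  have hmb : ∀ x, |m x| ≤ |t| * Q := fun x => (abs_exp_sub_one_le (hbs x)).trans
    ((mul_le_mul_of_nonneg_left (hbs x) (Real.exp_pos s).le).trans hesE)
  have hRL : HasLip R (t ^ 2 * Q') := ((htη.comp (F := fun z => Real.exp z - 1 - z)
    (mul_nonneg hs0 (Real.exp_pos s).le)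
    fun x y => abs_exp_remainder_sub_le (hbs x) (hbs y))).mono hesE2
  have hRb : ∀ x, |R x| ≤ t ^ 2 * Q' := fun x => (abs_exp_remainder_le (hbs x)).trans
    ((mul_le_mul_of_nonneg_left (hbs x) (mul_nonneg hs0 (Real.exp_pos s).le)).trans hesE2)
  have hlam1 : |lam - 1| ≤ |t| * Q := (hf.abs_eigenvalue_sub_one_le hd hlam
    (continuous_const.mul hηc) hbs hkc hk0 heig x₀).trans hesE
  have hmc := hmL.continuous hd
  have hRc := hRL.continuous hd
  set D : (ℕ → M) → ℝ := fun x => m x * (k x - 1) + R x with hD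
  have hDc : Continuous D := (hmc.mul (hkc.sub continuous_const)).add hRc
  -- Here `e^{tη} k = k + tη + D` with `D = m (k - 1) + R`. The only term of pure first order, `tη`,
  -- is killed by `L`.
  have hkD : ∀ x, lam * k x = ruelle ν f k x + ruelle ν f D x := by
    intro x
    have e : (fun y => Real.exp (t * η y) * k y) = fun y => (k y + t * η y) + D y := by
      ext y
      simp only [hD, hm, hR]
      ring
    have htc : Continuous fun y => t * η y := continuous_const.mul hηc
    rw [← heig, e, ruelle_add ν hfc (u := fun y => k y + t * η y) (hkc.add htc) hDc,
      ruelle_add ν hfc hkc htc, ruelle_const_mul, hη.2 x]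
    ring
  -- Bootstrap: in `k - L k = L D - (lam - 1) k` the constant `B` enters only with a factor `|t|`,
  -- and the rest is `O(t²)`. Inverting `1 - L` improves `B`, and `t₀` was chosen so that `a |t| ≤
  -- 1/2`.
  have himp : ∀ B, 0 ≤ B → HasLip k B → HasLip k (a * |t| * B + C₂ * C₁ * Q' * t ^ 2) := by
    intro B hB hkB
    have hk1L : HasLip (fun x => k x - 1) B := hkB.sub_const 1
    have hk1b : ∀ x, |k x - 1| ≤ B := fun x => by
      rw [← hk1]
      exact hkB.abs_sub_le hd hB x x₀
    have hDL := (hmL.mul hk1L hmb hk1b).add hRL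
    have hb1 : 0 ≤ |t| * Q * B + |t| * Q * B + t ^ 2 * Q' := by positivity
    have hLD := hL D _ hb1 hDL
    have hsub := hLD.sub (hkB.const_mul (lam - 1))
    have e : (fun x => k x - ruelle ν f k x) =
        fun x => ruelle ν f D x - (lam - 1) * k x := by
      ext x
      linarith [hkD x]
    rw [← e] at hsub
    have hsub' := hsub.mono (add_le_add_right (mul_le_mul_of_nonneg_right hlam1 hB) _)
    refine (hinv k _ (by positivity) hk hsub').mono (le_of_eq ?_)
    simp only [a]
    ring
  obtain ⟨B₀, hB₀, hkB₀⟩ := hk.exists_hasLip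
  have hb0 : 0 ≤ C₂ * C₁ * Q' * t ^ 2 := by positivity
  have hkL := HasLip.of_improve (by positivity) (by linarith : a * |t| < 1) hB₀ hb0 hkB₀ himp
  set B := 2 * (C₂ * C₁ * Q') * t ^ 2 with hBdef
  have hB : 0 ≤ B := by positivity
  have hkB : HasLip k B := hkL.mono (by
    rw [div_le_iff₀ (by linarith)]
    nlinarith)
  have hQ't : 0 ≤ Q' * t ^ 2 := by positivity
  have hQB : 0 ≤ Q * B := mul_nonneg hQ hB
  have hCe : (2 * (C₂ * C₁ * Q') * (1 + Q) + Q') * t ^ 2 = B + Q * B + Q' * t ^ 2 := by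
    rw [hBdef]
    ring
  rw [hCe]
  refine ⟨hkB.mono (by linarith), ?_⟩
  have hk1b : ∀ x, |k x - 1| ≤ B := fun x => by
    rw [← hk1]
    exact hkB.abs_sub_le hd hB x x₀
  have h1 := hf.abs_ruelle_le hd (u := fun x => k x - 1) (hkc.sub continuous_const) hk1b x₀
  have h2 := hf.abs_ruelle_le hd hDc (S := Q * B + Q' * t ^ 2) (fun x => by
    refine (abs_add_le _ _).trans ?_
    rw [abs_mul]
    have h3 := mul_le_mul (hmb x) (hk1b x) (abs_nonneg _) (by positivity)
    have h4 := mul_le_mul_of_nonneg_right ht1 hQB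
    linarith [hRb x]) x₀
  have h5 := hkD x₀
  have h6 := hf.ruelle_sub_const hd hkc 1 x₀
  rw [hk1, mul_one] at h5
  have e : lam - 1 = ruelle ν f (fun x => k x - 1) x₀ + ruelle ν f D x₀ := by
    rw [h6]
    linarith
  rw [e]
  exact (abs_add_le _ _).trans (by linarith)

/-- First order expansion of the normalized density `exp (t η) k / (lam k ∘ σ)`. -/
lemma IsNormalized.exists_density_estimate (hd : ∀ a b : M, dist a b ≤ 1) (hf : IsNormalized ν f)
    (hη : η ∈ ruelleKer ν f) (x₀ : ℕ → M) :
    ∃ C t₀ : ℝ, 0 ≤ C ∧ 0 < t₀ ∧ ∀ t lam k, |t| ≤ t₀ → 0 < lam → IsLip k → (∀ x, 0 < k x) →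
      (∀ x, ruelle ν f (fun y => Real.exp (t * η y) * k y) x = lam * k x) →
      ∀ x, |Real.exp (t * η x) * k x / (lam * k (shift x)) - 1 - t * η x| ≤ C * t ^ 2 := by
  obtain ⟨C, t₀, hC, ht₀, hest⟩ := hf.exists_eigen_estimate hd hη x₀
  obtain ⟨E, hE, hηb⟩ := exists_abs_le (hη.1.continuous hd)
  set Q := E * Real.exp E * E
  have hQ : 0 ≤ Q := by positivity
  refine ⟨2 * (2 * Q + (1 + E) * (4 * C)), min t₀ (min 1 (1 / (4 * (C + 1)))), by positivity,
    lt_min ht₀ (lt_min one_pos (by positivity)), fun t lam k' ht hlam hk' hk0' heig' x => ?_⟩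
  have ht1 : |t| ≤ 1 := (ht.trans (min_le_right _ _)).trans (min_le_left _ _)
  -- The density is invariant under scaling of the eigenfunction, so it may be normalized at `x₀`.
  set k : (ℕ → M) → ℝ := fun x => (k' x₀)⁻¹ * k' x with hkdef
  have hk1 : k x₀ = 1 := inv_mul_cancel₀ (hk0' x₀).ne'
  have hk0 : ∀ x, 0 < k x := fun x => mul_pos (inv_pos.2 (hk0' x₀)) (hk0' x)
  obtain ⟨B', -, hB'⟩ := hk'.exists_hasLip
  have hk : IsLip k := (hB'.const_mul _).isLip
  have heig : ∀ x, ruelle ν f (fun y => Real.exp (t * η y) * k y) x = lam * k x := fun x => by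
    have e : (fun y => Real.exp (t * η y) * k y) =
        fun y => (k' x₀)⁻¹ * (Real.exp (t * η y) * k' y) := by
      ext y
      simp only [hkdef]
      ring
    rw [e, ruelle_const_mul, heig' x]
    simp only [hkdef]
    ring
  have hq : Real.exp (t * η x) * k' x / (lam * k' (shift x)) =
      Real.exp (t * η x) * k x / (lam * k (shift x)) := by
    have h1 := (hk0' x₀).ne'
    have h2 := (hk0' (shift x)).ne'
    simp only [hkdef]
    field_simp
  rw [hq]
  obtain ⟨hkL, hlam1⟩ := hest t lam k (ht.trans (min_le_left _ _)) hlam hk hk0 heig hk1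
  set δ := C * t ^ 2 with hδ
  have hδ0 : 0 ≤ δ := by positivity
  have hδ1 : δ ≤ 1 / 4 := by
    have h1 : |t| ≤ 1 / (4 * (C + 1)) := (ht.trans (min_le_right _ _)).trans (min_le_right _ _)
    rw [le_div_iff₀ (by positivity)] at h1
    have h2 : t ^ 2 ≤ |t| := by
      rw [← sq_abs, sq]
      exact mul_le_of_le_one_left (abs_nonneg t) ht1
    nlinarith [abs_nonneg t]
  have hkb : ∀ y, |k y - 1| ≤ δ := fun y => by
    rw [← hk1]
    exact hkL.abs_sub_le hd hδ0 y x₀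
  have hx := abs_le.1 (hkb x)
  have hx' := abs_le.1 (hkb (shift x))
  have hl := abs_le.1 hlam1
  have hden : 1 / 2 ≤ lam * k (shift x) := by nlinarith
  have hdpos : 0 < lam * k (shift x) := by linarith
  have hR : |Real.exp (t * η x) - 1 - t * η x| ≤ Q * t ^ 2 := by
    have h1 : |t * η x| ≤ |t| * E := by
      rw [abs_mul]
      exact mul_le_mul_of_nonneg_left (hηb x) (abs_nonneg t)
    have h2 : |t| * E ≤ E := mul_le_of_le_one_left hE ht1
    calc _ ≤ |t| * E * Real.exp (|t| * E) * |t * η x| := abs_exp_remainder_le h1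
      _ ≤ |t| * E * Real.exp E * (|t| * E) :=
          mul_le_mul (mul_le_mul_of_nonneg_left (Real.exp_le_exp.2 h2) (by positivity)) h1
            (abs_nonneg _) (by positivity)
      _ = Q * |t| ^ 2 := by simp only [Q]; ring
      _ = Q * t ^ 2 := by rw [sq_abs]
  have hkk : |k x - lam * k (shift x)| ≤ 4 * δ := by
    have e : k x - lam * k (shift x) =
        (k x - 1) - (k (shift x) - 1) - (lam - 1) * k (shift x) := by ring
    have h1 : |(lam - 1) * k (shift x)| ≤ δ * 2 := by
      rw [abs_mul, abs_of_pos (hk0 _)]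
      exact mul_le_mul hlam1 (by linarith) (hk0 _).le hδ0
    rw [abs_le] at h1
    rw [e, abs_le]
    constructor <;> linarith
  have h1η : |1 + t * η x| ≤ 1 + E := by
    refine (abs_add_le _ _).trans ?_
    rw [abs_one, abs_mul]
    have := mul_le_mul ht1 (hηb x) (abs_nonneg _) zero_le_one
    linarith
  have e : Real.exp (t * η x) * k x / (lam * k (shift x)) - 1 - t * η x =
      ((Real.exp (t * η x) - 1 - t * η x) * k x + (1 + t * η x) * (k x - lam * k (shift x))) /
        (lam * k (shift x)) := by
    rw [eq_div_iff hdpos.ne', sub_mul, sub_mul, div_mul_cancel₀ _ hdpos.ne']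
    ring
  rw [e, abs_div, abs_of_pos hdpos, div_le_iff₀ hdpos]
  have h3 : |(Real.exp (t * η x) - 1 - t * η x) * k x| ≤ Q * t ^ 2 * 2 := by
    rw [abs_mul, abs_of_pos (hk0 x)]
    exact mul_le_mul hR (by linarith) (hk0 x).le (by positivity)
  have h4 : |(1 + t * η x) * (k x - lam * k (shift x))| ≤ (1 + E) * (4 * δ) := by
    rw [abs_mul]
    exact mul_le_mul h1η hkk (abs_nonneg _) (by positivity)
  have h5 : 0 ≤ 2 * (2 * Q + (1 + E) * (4 * C)) * t ^ 2 := by positivity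
  calc _ ≤ Q * t ^ 2 * 2 + (1 + E) * (4 * δ) := (abs_add_le _ _).trans (add_le_add h3 h4)
    _ = 2 * (2 * Q + (1 + E) * (4 * C)) * t ^ 2 * (1 / 2) := by rw [hδ]; ring
    _ ≤ _ := mul_le_mul_of_nonneg_left hden h5

end Perturbation

/-! ### Gibbs probabilities and linear response. -/

lemma abs_integral_le_of_abs_le {X : Type*} [MeasurableSpace X] (μ : Measure X)
    [IsProbabilityMeasure μ] {u : X → ℝ} {C : ℝ} (h : ∀ x, |u x| ≤ C) : |∫ x, u x ∂μ| ≤ C := by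
  have := norm_integral_le_of_norm_le_const (μ := μ) (f := u) (C := C) (Eventually.of_forall h)
  simpa using this

lemma abs_integral_sub_le_of_abs_le {X : Type*} [MeasurableSpace X] {μ : Measure X}
    [IsProbabilityMeasure μ] {u w : X → ℝ} {C : ℝ} (hu : Integrable u μ) (hw : Integrable w μ)
    (h : ∀ x, |u x - w x| ≤ C) : |∫ x, u x ∂μ - ∫ x, w x ∂μ| ≤ C := by
  rw [← integral_sub hu hw]
  exact abs_integral_le_of_abs_le μ h

/-- `μ` is fixed by the dual of `u ↦ L_f (q u)`, where `q` is a normalized density close to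
`1 + t η` up to an error `ε`. -/
structure IsDensityFixed {M : Type*} [MetricSpace M] [MeasurableSpace M] (ν : Measure M)
    (f η : (ℕ → M) → ℝ) (t ε : ℝ) (μ : Measure (ℕ → M)) (q : (ℕ → M) → ℝ) : Prop where
  prob : IsProbabilityMeasure μ
  cont : Continuous q
  norm : ∀ x, ruelle ν f q x = 1
  fixed : ∀ u, Continuous u → ∫ x, ruelle ν f (fun y => q y * u y) x ∂μ = ∫ x, u x ∂μ
  close : ∀ x, |q x - 1 - t * η x| ≤ ε

/-- Since `u ∘ σ` forgets the first symbol, `L (q · u∘σ) = u · L q = u`. -/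
lemma IsDensityFixed.integral_comp_shift {M : Type*} [MetricSpace M] [MeasurableSpace M]
    {ν : Measure M} {f η u q : (ℕ → M) → ℝ} {t ε : ℝ} {μ : Measure (ℕ → M)}
    (h : IsDensityFixed ν f η t ε μ q) (hu : Continuous u) :
    ∫ x, u (shift x) ∂μ = ∫ x, u x ∂μ := by
  rw [← h.fixed (fun x => u (shift x)) (hu.comp continuous_shift)]
  congr 1
  ext x
  have h1 := h.norm x
  simp only [ruelle, shift_prepend] at h1 ⊢
  simp only [← mul_assoc, integral_mul_const, h1, one_mul]

section Main

variable {M : Type*} [MetricSpace M] [CompactSpace M] [MeasurableSpace M] [BorelSpace M]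
  {ν : Measure M} [IsProbabilityMeasure ν] {f F g η u v : (ℕ → M) → ℝ} {t : ℝ}
  {μ μ₀ : Measure (ℕ → M)}

lemma exists_isLipschitzGibbs (hd : ∀ a b : M, dist a b ≤ 1) (hF : IsLip F) (x₀ : ℕ → M) :
    ∃ μ, IsLipschitzGibbs ν F μ := by
  obtain ⟨lam, h, hlam, hh, hh0, heig⟩ := exists_isPosEigenpair (ν := ν) hd hF x₀
  have hFc := hF.continuous hd
  have hhc := hh.continuous hd
  have hN : Continuous (normalization F lam h) :=
    ((hFc.add (hhc.log fun x => (hh0 x).ne')).sub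
      ((hhc.comp continuous_shift).log fun x => (hh0 _).ne')).sub continuous_const
  have h1 : ∀ x, ruelle ν (normalization F lam h) (fun _ => 1) x = 1 := by
    intro x
    have e : ∀ a, Real.exp (normalization F lam h (prepend a x)) * 1 =
        (lam * h x)⁻¹ * (Real.exp (F (prepend a x)) * h (prepend a x)) := fun a => by
      simp only [normalization, shift_prepend, Real.exp_sub, Real.exp_add, Real.exp_log (hh0 _),
        Real.exp_log hlam]
      have h1 := (hh0 x).ne'
      field_simp
    simp only [ruelle, e, integral_const_mul]
    have := heig x
    simp only [ruelle] at this
    rw [this]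
    exact inv_mul_cancel₀ (mul_pos hlam (hh0 x)).ne'
  obtain ⟨μ, hμ, hfix⟩ := exists_isDualFixed (ν := ν) hN h1 x₀
  exact ⟨μ, hμ, lam, h, ⟨hlam, hh, hh0, heig⟩, hfix⟩

lemma isLipschitzGibbs_gibbs {M : Type*} [MetricSpace M] [MeasurableSpace M] {ν : Measure M}
    {F : (ℕ → M) → ℝ} (h : ∃ μ, IsLipschitzGibbs ν F μ) :
    IsLipschitzGibbs ν F (gibbs ν F) := by
  rw [gibbs, dif_pos h]
  exact h.choose_spec

/-- Gibbs probabilities of `f + t g`, with `g` cohomologous to `η ∈ Ker L_f`. -/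
lemma IsNormalized.exists_isDensityFixed (hd : ∀ a b : M, dist a b ≤ 1) (hf : IsNormalized ν f)
    (hη : η ∈ ruelleKer ν f) (hg : IsLip g) (hv : Continuous v)
    (hgη : ∀ x, g x = η x + (v x - v (shift x))) (x₀ : ℕ → M) :
    ∃ C t₀ : ℝ, 0 ≤ C ∧ 0 < t₀ ∧ ∀ t μ, |t| ≤ t₀ →
      IsLipschitzGibbs ν (fun y => f y + t * g y) μ →
      ∃ q, IsDensityFixed ν f η t (C * t ^ 2) μ q := by
  obtain ⟨C, t₀, hC, ht₀, hest⟩ := hf.exists_density_estimate hd hη x₀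
  refine ⟨C, t₀, hC, ht₀, fun t μ ht hμ => ?_⟩
  obtain ⟨hprob, lam, h, ⟨hlam, hh, hh0, heig⟩, hfix⟩ := hμ
  have hηc := hη.1.continuous hd
  have hhc := hh.continuous hd
  obtain ⟨G, hG, hgG⟩ := hg.exists_hasLip
  obtain ⟨E, hE, hηE⟩ := hη.1.exists_hasLip
  -- Lipschitz regularity of `v`, not just continuity, is what makes `e^{tv} h` an admissible
  -- eigenfunction for the density estimate.
  have hvL : HasLip v (G + E) := by
    refine HasLip.of_coboundary hd hv ?_
    have e : (fun x => v x - v (shift x)) = fun x => g x - η x := by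
      ext x
      linarith [hgη x]
    rw [e]
    exact hgG.sub hηE
  set k : (ℕ → M) → ℝ := fun x => Real.exp (t * v x) * h x with hkdef
  have hk0 : ∀ x, 0 < k x := fun x => mul_pos (Real.exp_pos _) (hh0 x)
  have htv := hvL.const_mul t
  have htvc := htv.continuous hd
  have hk : IsLip k := by
    obtain ⟨S, hS, hvS⟩ := exists_abs_le htvc
    obtain ⟨S', hS', hhS⟩ := exists_abs_le hhc
    obtain ⟨H, hH, hhH⟩ := hh.exists_hasLip
    exact ((htv.comp (F := Real.exp) (Real.exp_pos S).le
      (fun x y => abs_exp_sub_exp_le (hvS x) (hvS y))).mul hhH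
      (fun x => by
        rw [abs_of_pos (Real.exp_pos _)]
        exact Real.exp_le_exp.2 (abs_le.1 (hvS x)).2) hhS).isLip
  have hkc := hk.continuous hd
  have hkeig : ∀ x, ruelle ν f (fun y => Real.exp (t * η y) * k y) x = lam * k x := by
    intro x
    have e : ∀ a, Real.exp (f (prepend a x)) *
        (Real.exp (t * η (prepend a x)) * k (prepend a x)) =
        Real.exp (t * v x) * (Real.exp (f (prepend a x) + t * g (prepend a x)) *
          h (prepend a x)) := fun a => by
      simp only [hkdef, hgη, shift_prepend, ← mul_assoc, ← Real.exp_add]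
      congr 2
      ring
    have h1 := heig x
    simp only [ruelle] at h1 ⊢
    simp only [e, integral_const_mul, h1]
    simp only [hkdef]
    ring
  set q : (ℕ → M) → ℝ := fun x => Real.exp (t * η x) * k x / (lam * k (shift x)) with hq
  have hqc : Continuous q := ((Real.continuous_exp.comp (continuous_const.mul hηc)).mul hkc).div
    (continuous_const.mul (hkc.comp continuous_shift)) fun x => (mul_pos hlam (hk0 _)).ne'
  refine ⟨q, hprob, hqc, fun x => ?_, fun u hu => ?_, hest t lam k ht hlam hk hk0 hkeig⟩
  · have e : ∀ a, Real.exp (f (prepend a x)) * q (prepend a x) = (lam * k x)⁻¹ *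
        (Real.exp (f (prepend a x)) * (Real.exp (t * η (prepend a x)) * k (prepend a x))) :=
      fun a => by
        simp only [hq, shift_prepend]
        ring
    have h1 := hkeig x
    simp only [ruelle] at h1 ⊢
    simp only [e, integral_const_mul, h1]
    exact inv_mul_cancel₀ (mul_pos hlam (hk0 x)).ne'
  · rw [← hfix u hu]
    congr 1
    ext x
    simp only [ruelle]
    congr 1
    ext a
    rw [← mul_assoc]
    congr 1
    simp only [normalization, hq, hkdef, hgη, shift_prepend, Real.exp_sub, Real.exp_add,
      Real.exp_log (hh0 _), Real.exp_log hlam, mul_add, mul_sub]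
    have h1 := (hh0 x).ne'
    field_simp

/-- Replace `∫ u dμ` by `∫ L(q u) dμ` and expand `q`; `L` does not increase sup norms. For `t = ε =
0` it yields exact invariance, `∫ L u dμ = ∫ u dμ`. -/
lemma IsDensityFixed.abs_integral_sub_le {ε S : ℝ} {q : (ℕ → M) → ℝ}
    (hd : ∀ a b : M, dist a b ≤ 1) (hf : IsNormalized ν f) (hη : Continuous η)
    (h : IsDensityFixed ν f η t ε μ q) (hu : Continuous u) (hS : ∀ x, |u x| ≤ S) :
    |∫ x, u x ∂μ - ∫ x, ruelle ν f u x ∂μ - t * ∫ x, ruelle ν f (fun y => η y * u y) x ∂μ|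
      ≤ ε * S := by
  have hprob := h.prob
  have hfc := hf.1.continuous hd
  have hq := h.cont
  have hqu : Continuous fun y => q y * u y := hq.mul hu
  have hηu : Continuous fun y => η y * u y := hη.mul hu
  have hi : ∀ {w : (ℕ → M) → ℝ}, Continuous w → Integrable (ruelle ν f w) μ := fun hw =>
    Continuous.integrable_of_compactSpace μ (continuous_ruelle ν hfc hw)
  have hi' : Integrable (fun x => ruelle ν f (fun y => q y * u y) x - ruelle ν f u x) μ :=
    (hi hqu).sub (hi hu)
  rw [← h.fixed u hu, ← integral_const_mul, ← integral_sub (hi hqu) (hi hu),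
    ← integral_sub hi' ((hi hηu).const_mul t)]
  refine abs_integral_le_of_abs_le μ fun x => ?_
  rw [← ruelle_const_mul, ← ruelle_sub ν hfc hqu hu,
    ← ruelle_sub ν hfc (u := fun y => q y * u y - u y) (w := fun y => t * (η y * u y))
      (hqu.sub hu) (continuous_const.mul hηu)]
  refine hf.abs_ruelle_le hd (u := fun y => q y * u y - u y - t * (η y * u y))
    ((hqu.sub hu).sub (continuous_const.mul hηu)) (fun y => ?_) x
  have e : q y * u y - u y - t * (η y * u y) = (q y - 1 - t * η y) * u y := by ring
  rw [e, abs_mul]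
  exact mul_le_mul (h.close y) (hS y) (abs_nonneg _) ((abs_nonneg _).trans (h.close y))

/-- Lipschitz continuity at `t = 0` of the integral of a Lipschitz function. -/
lemma IsNormalized.exists_abs_integral_sub_le (hd : ∀ a b : M, dist a b ≤ 1)
    (hf : IsNormalized ν f) (hη : Continuous η) (x₀ : ℕ → M) (hu : IsLip u) {C : ℝ} (hC : 0 ≤ C) :
    ∃ C', 0 ≤ C' ∧ ∀ t μ μ₀ q q₀, |t| ≤ 1 → IsDensityFixed ν f η t (C * t ^ 2) μ q →
      IsDensityFixed ν f η 0 0 μ₀ q₀ →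
      |∫ x, u x ∂μ - ∫ x, u x ∂μ₀| ≤ C' * |t| := by
  obtain ⟨C₀, θ, hC₀, hθ0, hθ1, hgap⟩ := hf.exists_gap hd x₀
  obtain ⟨E, hE, hηb⟩ := exists_abs_le hη
  obtain ⟨B, hB, huB⟩ := hu.exists_hasLip
  have huc := huB.continuous hd
  have hfc := hf.1.continuous hd
  have hθ : 0 < 1 - θ := by linarith
  refine ⟨(C + E) * (C₀ * B) / (1 - θ), by positivity, fun t μ μ₀ q q₀ ht h h₀ => ?_⟩
  have hprob := h.prob
  have hprob₀ := h₀.prob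
  set U : ℕ → (ℕ → M) → ℝ := fun n => (ruelle ν f)^[n] u with hU
  have hUc : ∀ n, Continuous (U n) := fun n => continuous_iterate_ruelle hfc huc n
  have hUs : ∀ n, ruelle ν f (U n) = U (n + 1) := fun n =>
    (Function.iterate_succ_apply' _ _ _).symm
  have hUb : ∀ n x, |U n x - U n x₀| ≤ C₀ * B * θ ^ n := fun n x =>
    (hgap u B hB huB n).abs_sub_le hd (by positivity) x x₀
  have hint : ∀ (μ : Measure (ℕ → M)) [IsProbabilityMeasure μ] n, Integrable (U n) μ :=
    fun μ _ n => Continuous.integrable_of_compactSpace μ (hUc n)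
  -- Centering `U n` at `x₀` leaves the difference unchanged and makes the function of size `θ ^ n`,
  -- so the errors are summable in `n`.
  have hstep : ∀ n, |∫ x, U n x ∂μ - ∫ x, U (n + 1) x ∂μ| ≤
      (C + E) * |t| * (C₀ * B * θ ^ n) := by
    intro n
    have hwc : Continuous fun y => U n y - U n x₀ := (hUc n).sub continuous_const
    have h1 := h.abs_integral_sub_le hd hf hη hwc (hUb n)
    simp only [hf.ruelle_sub_const hd (hUc n), hUs] at h1
    rw [integral_sub (hint μ n) (integrable_const _),
      integral_sub (hint μ (n + 1)) (integrable_const _)] at h1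
    have h2 : |∫ x, ruelle ν f (fun y => η y * (U n y - U n x₀)) x ∂μ| ≤
        E * (C₀ * B * θ ^ n) := by
      refine abs_integral_le_of_abs_le μ fun x => hf.abs_ruelle_le hd (hη.mul hwc) (fun y => ?_) x
      simp only [Pi.mul_apply, abs_mul]
      exact mul_le_mul (hηb y) (hUb n y) (abs_nonneg _) hE
    have h3 : |t * ∫ x, ruelle ν f (fun y => η y * (U n y - U n x₀)) x ∂μ| ≤
        |t| * (E * (C₀ * B * θ ^ n)) := by
      rw [abs_mul]
      exact mul_le_mul_of_nonneg_left h2 (abs_nonneg t)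
    have h4 : C * t ^ 2 * (C₀ * B * θ ^ n) ≤ C * |t| * (C₀ * B * θ ^ n) := by
      have : t ^ 2 ≤ |t| := by
        rw [← sq_abs, sq]
        exact mul_le_of_le_one_left (abs_nonneg t) ht
      gcongr
    rw [abs_le] at h1 h3 ⊢
    constructor <;> linarith
  have hstep₀ : ∀ n, ∫ x, U n x ∂μ₀ = ∫ x, u x ∂μ₀ := by
    intro n
    induction n with
    | zero => rfl
    | succ n ih =>
      obtain ⟨S, -, hS⟩ := exists_abs_le (hUc n)
      have h1 := h₀.abs_integral_sub_le hd hf hη (hUc n) hS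
      rw [zero_mul, zero_mul, sub_zero, hUs] at h1
      have := abs_nonpos_iff.1 h1
      linarith
  have hsum : ∀ n, |∫ x, u x ∂μ - ∫ x, U n x ∂μ| ≤
      (C + E) * (C₀ * B) / (1 - θ) * |t| * (1 - θ ^ n) := by
    intro n
    induction n with
    | zero => simp [hU]
    | succ n ih =>
      have h1 := abs_add_le (∫ x, u x ∂μ - ∫ x, U n x ∂μ) (∫ x, U n x ∂μ - ∫ x, U (n + 1) x ∂μ)
      rw [sub_add_sub_cancel] at h1
      refine (h1.trans (add_le_add ih (hstep n))).trans (le_of_eq ?_)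
      field_simp
      ring
  -- Both probabilities integrate the nearly constant `U n` to about `U n x₀`, which links `μ` to
  -- `μ₀`.
  have hn : ∀ n, |∫ x, u x ∂μ - ∫ x, u x ∂μ₀| ≤
      (C + E) * (C₀ * B) / (1 - θ) * |t| * (1 - θ ^ n) + 2 * (C₀ * B * θ ^ n) := by
    intro n
    have h1 := abs_integral_sub_le_of_abs_le (hint μ n) (integrable_const (U n x₀)) (hUb n)
    have h2 := abs_integral_sub_le_of_abs_le (hint μ₀ n) (integrable_const (U n x₀)) (hUb n)
    rw [hstep₀] at h2
    have h3 := hsum n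
    simp only [integral_const, probReal_univ, one_smul] at h1 h2
    rw [abs_le] at *
    constructor <;> linarith
  have hp := tendsto_pow_atTop_nhds_zero_of_lt_one hθ0 hθ1
  refine (ge_of_tendsto' (((hp.const_sub 1).const_mul _).add
    ((hp.const_mul (C₀ * B)).const_mul 2)) hn).trans (le_of_eq ?_)
  ring

end Main

lemma hasDerivAt_zero_of_quadratic {F : ℝ → ℝ} {D C t₀ : ℝ} (ht₀ : 0 < t₀)
    (h : ∀ t, |t| ≤ t₀ → |F t - F 0 - t * D| ≤ C * t ^ 2) : HasDerivAt F D 0 := by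
  rw [hasDerivAt_iff_isLittleO]
  simp only [sub_zero, smul_eq_mul]
  have h1 : (fun t => F t - F 0 - t * D) =O[𝓝 0] fun t : ℝ => t ^ 2 := by
    refine Asymptotics.IsBigO.of_bound C ?_
    filter_upwards [Metric.closedBall_mem_nhds (0 : ℝ) ht₀] with t ht
    rw [Real.norm_eq_abs, Real.norm_of_nonneg (sq_nonneg t)]
    exact h t (by simpa using ht)
  have h2 : (fun t : ℝ => t ^ 2) =o[𝓝 0] fun t : ℝ => t := by
    simpa using Asymptotics.isLittleO_pow_pow (𝕜 := ℝ) (m := 1) (n := 2) (by norm_num)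
  exact h1.trans_isLittleO h2

theorem corollary5p4 {M : Type*} [MetricSpace M] [CompactSpace M] [MeasurableSpace M]
    [BorelSpace M] (hdiam : Metric.diam (Set.univ : Set M) = 1)
    (ν : Measure M) [IsProbabilityMeasure ν] [ν.IsOpenPosMeasure]
    (f g φ : (ℕ → M) → ℝ) (hf : IsNormalized ν f) (hg : IsLip g) (hφ : IsLip φ)
    (v w η ξ : (ℕ → M) → ℝ) (c : ℝ) (hv : Continuous v) (hw : Continuous w)
    (hη : η ∈ ruelleKer ν f) (hξ : ξ ∈ ruelleKer ν f)
    (hgη : ∀ x, g x = η x + (v x - v (shift x)))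
    (hφξ : ∀ x, φ x = ξ x + (w x - w (shift x)) + c) :
    HasDerivAt (fun t : ℝ => ∫ x, φ x ∂(gibbs ν (fun y => f y + t * g y)))
      (∫ x, ξ x * η x ∂(gibbs ν f)) 0 := by
  have hd : ∀ a b : M, dist a b ≤ 1 := fun a b => hdiam ▸
    Metric.dist_le_diam_of_mem isCompact_univ.isBounded trivial trivial
  have : Nonempty M := nonempty_of_isProbabilityMeasure ν
  let x₀ : ℕ → M := fun _ => Classical.arbitrary M
  obtain ⟨C, t₀, hC, ht₀, hdens⟩ := hf.exists_isDensityFixed hd hη hg hv hgη x₀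
  have hηc := hη.1.continuous hd
  have hξc := hξ.1.continuous hd
  obtain ⟨S, hS, hξS⟩ := exists_abs_le hξc
  have hgibbs : ∀ t : ℝ, IsLipschitzGibbs ν (fun y => f y + t * g y)
      (gibbs ν fun y => f y + t * g y) := fun t => by
    refine isLipschitzGibbs_gibbs (exists_isLipschitzGibbs hd ?_ x₀)
    obtain ⟨K, -, hK⟩ := hf.1.exists_hasLip
    obtain ⟨G, -, hG⟩ := hg.exists_hasLip
    exact (hK.add (hG.const_mul t)).isLip
  have e0 : (fun y => f y + 0 * g y) = f := by simp
  -- At `t = 0` the error `C * t ^ 2` vanishes, so the relations for `gibbs ν f` are exact.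
  have hzero : ∃ q₀, IsDensityFixed ν f η 0 0 (gibbs ν f) q₀ := by
    have := hdens 0 _ (by simpa using ht₀.le) (hgibbs 0)
    simpa [e0] using this
  obtain ⟨q₀, h₀⟩ := hzero
  have hLip : IsLip fun x => η x * ξ x := by
    obtain ⟨E, -, hE⟩ := hη.1.exists_hasLip
    obtain ⟨X, -, hX⟩ := hξ.1.exists_hasLip
    obtain ⟨S', -, hηS⟩ := exists_abs_le hηc
    exact (hE.mul hX hηS hξS).isLip
  have hLc := hLip.continuous hd
  have hψ : IsLip (ruelle ν f fun x => η x * ξ x) := by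
    obtain ⟨B, hB, hLB⟩ := hLip.exists_hasLip
    obtain ⟨_, _, -, -, -, hgap⟩ := hf.exists_gap hd x₀
    exact (hgap _ B hB hLB 1).isLip
  obtain ⟨C', hC', hcont⟩ := hf.exists_abs_integral_sub_le hd hηc x₀ hψ hC
  have hφint : ∀ {t ε μ q}, IsDensityFixed ν f η t ε μ q → ∫ x, φ x ∂μ = ∫ x, ξ x ∂μ + c := by
    intro t ε μ q h
    have hprob := h.prob
    have hi : ∀ {u : (ℕ → M) → ℝ}, Continuous u → Integrable u μ := fun hu =>
      Continuous.integrable_of_compactSpace μ hu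
    have hws : Continuous fun x => w (shift x) := hw.comp continuous_shift
    have hwi : Integrable (fun x => w x - w (shift x)) μ := (hi hw).sub (hi hws)
    have hξi : Integrable (fun x => ξ x + (w x - w (shift x))) μ := (hi hξc).add hwi
    simp only [hφξ]
    rw [integral_add hξi (integrable_const c), integral_add (hi hξc) hwi, integral_sub (hi hw) (hi hws),
      h.integral_comp_shift hw]
    simp
  have hξint : ∀ {t ε μ q}, IsDensityFixed ν f η t ε μ q →
      |∫ x, ξ x ∂μ - t * ∫ x, ruelle ν f (fun y => η y * ξ y) x ∂μ| ≤ ε * S := by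
    intro t ε μ q h
    have h1 := h.abs_integral_sub_le hd hf hηc hξc hξS
    simpa [hξ.2] using h1
  have hξ0 : ∫ x, ξ x ∂(gibbs ν f) = 0 := by
    simpa using hξint h₀
  have hψ0 : ∫ x, ruelle ν f (fun y => η y * ξ y) x ∂(gibbs ν f) =
      ∫ x, ξ x * η x ∂(gibbs ν f) := by
    obtain ⟨S', -, hS'⟩ := exists_abs_le hLc
    have h1 := h₀.abs_integral_sub_le hd hf hηc hLc hS'
    rw [zero_mul, zero_mul, sub_zero, abs_nonpos_iff] at h1
    simp only [mul_comm (ξ _)]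
    linarith
  refine hasDerivAt_zero_of_quadratic (C := C * S + C') (lt_min ht₀ one_pos) fun t ht => ?_
  obtain ⟨q, hq⟩ := hdens t _ (ht.trans (min_le_left _ _)) (hgibbs t)
  have h1 := hξint hq
  have h2 := hcont t _ _ q q₀ (ht.trans (min_le_right _ _)) hq h₀
  rw [hψ0] at h2
  simp only [e0]
  rw [hφint hq, hφint h₀, hξ0]
  set I := ∫ x, ξ x ∂(gibbs ν fun y => f y + t * g y)
  set J := ∫ x, ruelle ν f (fun y => η y * ξ y) x ∂(gibbs ν fun y => f y + t * g y)
  set D := ∫ x, ξ x * η x ∂(gibbs ν f)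
  -- The first bracket is the second-order error of the density expansion; the second is `t` times
  -- the `O(|t|)` variation of the measure.
  have e : I + c - (0 + c) - t * D = (I - t * J) + t * (J - D) := by ring
  rw [e]
  refine (abs_add_le _ _).trans ?_
  have h3 : |t * (J - D)| ≤ C' * t ^ 2 := by
    rw [abs_mul]
    refine (mul_le_mul_of_nonneg_left h2 (abs_nonneg t)).trans (le_of_eq ?_)
    rw [← sq_abs t]
    ring
  linarith
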